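/- **Syntax.** Let $\mathcal B$ be a set of base types and $T(\mathcal B)$ the simple types over $\mathcal B$ built with $\to$. An alphabet $\mathcal A$ consists of $\mathcal B$, pairwise disjoint infinite sets $X_t$ of variables of type $t$, sets $F_{s_1,\dots,s_n,s}$ of function symbols and sets $Z_{s_1,\dots,s_n,s}$ of metavariables ($n\ge 0$; $t,s_i,s\in T(\mathcal B)$), all pairwise disjoint. Metaterms are the well-typed expressions, modulo renaming of bound variables, generated by: $x$ of type $t$ for $x\in X_t$; $[x]u$ of type $s\to t$ for $x\in X_s$ and $u$ of type $t$; $f(u_1,\dots,u_n)$ and $Z(u_1,\dots,u_n)$ of type $s$ for $f\in F_{s_1,\dots,s_n,s}$, $Z\in Z_{s_1,\dots,s_n,s}$ and $u_i$ of type $s_i$. A term is a metaterm without metavariables. A rewrite rule is a pair $l\to r$ of metaterms of the same type without free variables such that $l$ has the form $f(\vec l)$, every metavariable of $l$ is applied to a sequence of distinct bound variables, and every metavariable of $r$ occurs in $l$. A valuation $\sigma$ maps every metavariable $Z\in Z_{s_1,\dots,s_n,s}$ to a substitute $\underline\lambda(x_1,\dots,x_n).v$, where the $x_i$ are distinct variables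 of type $s_i$ and $v$ is a term of type $s$; $u\sigma$ is obtained by replacing each $Z(\vec u)$ by $v\{\vec x\mapsto\vec u\sigma\}$, without capture of the free variables of the substitutes. An IDTS $\mathcal I=(\mathcal A,\mathcal R)$ is an alphabet with a set $\mathcal R$ of rules; $\to_{\mathcal I}$ is the closure, under abstractions and function symbols, of the relation on terms of all pairs $(l\sigma,r\sigma)$ with $l\to r$ in $\mathcal R$ and $\sigma$ a valuation. It is a $\beta$-IDTS if for all types $s,t$ there are a symbol $@_{s,t}\in F_{s\to t,s,t}$ (written $@$) and a rule $@([x]Z(x),Z')\to Z(Z')$ in $\mathcal R$, and no other rule (up to the names of $Z,Z'$) has a left-hand side headed by $@_{s,t}$. Write $@(v,u_1,\dots,u_n)$ for $@(\dots@(@(v,u_1),u_2)\dots,u_n)$. **Types.** For each base type $b$ let a set $C_b$ of function symbols with result type $b$ be given, the constructors of $b$. Let $b\ge_{\mathcal B}d$ be the reflexive transitive closure of "$d$ occurs in the type of an argument of some constructor of $b$", with equivalence $=_{\mathcal B}$ and strict part $>_{\mathcal B}$. A constructor of $b$ is positive if every base type $d=_{\mathcal B}b$ occurs only at positive positions in the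 types of its arguments; it is basic if it is positive and all its arguments have base types. A base type $b$ is basic if, for every $d\le_{\mathcal B}b$, all the constructors of $d$ are basic. **Accessibility.** $\mathrm{Acc}(v)$ is the smallest set of metaterms such that: $v\in\mathrm{Acc}(v)$; if $[x]u\in\mathrm{Acc}(v)$ then $u\in\mathrm{Acc}(v)$; if $c(\vec u)\in\mathrm{Acc}(v)$ with $c$ a constructor then each $u_i\in\mathrm{Acc}(v)$; if $f(\vec u)\in\mathrm{Acc}(v)$ with $f$ a function symbol and $u_i$ is of basic type then $u_i\in\mathrm{Acc}(v)$; if $@(u,x)\in\mathrm{Acc}(v)$ with $x$ a variable not free in $u$ or $v$ then $u\in\mathrm{Acc}(v)$; if $@(x,\vec u)\in\mathrm{Acc}(v)$ with $x$ a variable not free in $\vec u$ or $v$ then each $u_i\in\mathrm{Acc}(v)$. A metavariable $Z$ is accessible in $\vec l$ if $Z(\vec x)\in\mathrm{Acc}(l_i)$ for some $i$ and some distinct bound variables $\vec x$. **Orderings.** A metaterm $u$ is a covered subterm of $v$ if $v=[x_1]\dots[x_k]w$ and $u=[x_1]\dots[x_k]w'$ ($k\ge0$), where $w'$ is the subterm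 of $w$ at a position strictly above which $w$ has only function symbols; it is a strict one if also $u\ne v$. A status is a finite list of sets of argument positions. It compares two sequences of metaterms lexicographically along the list, comparing for each set the multisets of the arguments at its positions by the multiset extension of the strict covered-subterm relation; in particular it may be the lexicographic or the multiset comparison of the arguments. Let each function symbol $f$ have a status $\mathrm{stat}_f$, and write $\vec u\lhd_{\mathrm{stat}_f}\vec l$ for the resulting strict comparison. Let $g\ge_{\mathcal F}f$ be the reflexive transitive closure of "$f$ occurs in the right-hand side of some rule whose left-hand side is headed by $g$", with equivalence $=_{\mathcal F}$ and strict part $>_{\mathcal F}$. **General Schema.** The computable closure $\mathcal{CC}_f(\vec l)$ is the smallest set of metaterms that contains all variables; contains $Z(\vec u)$ whenever $Z$ is accessible in $\vec l$ and the $u_i$ are in the set; contains $c(\vec u)$ for every constructor $c$, $@(u,v)$, $[x]u$, and $h(\vec u)$ for every $h<_{\mathcal F}f$, whenever their immediate subterms are in the set and the types fit; and contains $g(\vec u)$ whenever $g=_{\mathcal F}f$, $g$ has at least one argument, the $u_i$ are in the set and of the right types, and $\vec u\lhd_{\mathrm{stat}_f}\vec l$. A rule $f(\vec l)\to r$ follows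 the General Schema if $r\in\mathcal{CC}_f(\vec l)$. **Theorem.** Let $\mathcal I=(\mathcal A,\mathcal R)$ be a $\beta$-IDTS, with constructors and statuses as above, such that (1) every constructor is positive; (2) no left-hand side of a rule is headed by a constructor; (3) $>_{\mathcal B}$ and $>_{\mathcal F}$ are well-founded; (4) $\mathrm{stat}_f=\mathrm{stat}_g$ whenever $f=_{\mathcal F}g$. If all rules of $\mathcal R$ follow the General Schema, then $\to_{\mathcal I}$ is strongly normalizing: there is no infinite sequence of terms $u_0\to_{\mathcal I}u_1\to_{\mathcal I}\cdots$. -/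

import Mathlib

namespace IDTS

universe u v w z m

/-- Simple types over a set of base types. -/
inductive Ty (B : Type u) : Type u
  | base (b : B) : Ty B
  | arr (s t : Ty B) : Ty B

/-- `OccursAt pol b t`: the base type `b` occurs in `t` at a position of polarity `pol`
(`true` is positive, `false` is negative). -/
def Ty.OccursAt {B : Type u} : Bool → B → Ty B → Prop
  | pol, b, .base a => a = b ∧ pol = true
  | pol, b, .arr s t => s.OccursAt (!pol) b ∨ t.OccursAt pol b

/-- The base type `b` occurs in `t`. -/
def Ty.Occurs {B : Type u} (b : B) (t : Ty B) : Prop :=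
  ∃ pol : Bool, t.OccursAt pol b

/-- The type `s₁ → … → sₙ → t`. -/
def Ty.arrows {B : Type u} : List (Ty B) → Ty B → Ty B
  | [], t => t
  | s :: ss, t => .arr s (Ty.arrows ss t)

/-- An alphabet: base types, typed variables (infinitely many of each type), typed function
symbols of fixed arity and typed metavariables of fixed arity. The families are indexed by
(argument types and) result type, so members of different families are never identified. -/
structure Alphabet where
  B : Type u
  X : Ty B → Type v
  F : List (Ty B) → Ty B → Type w
  Z : List (Ty B) → Ty B → Type z
  infinite_X : ∀ t, Infinite (X t)

/-- Bound variables (de Bruijn indices): `Var Γ t` is the set of positions of the type `t`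
in the list `Γ`. It also indexes the argument places of a symbol with argument types `Γ`. -/
inductive Var {T : Type u} : List T → T → Type u
  | zero {Γ : List T} {t : T} : Var (t :: Γ) t
  | succ {Γ : List T} {s t : T} (x : Var Γ t) : Var (s :: Γ) t

/-- Well-typed terms modulo renaming of bound variables, with metavariables from the family `M`.
Free variables are the named ones (`fvar`); bound variables are de Bruijn indices (`bvar`), and
`Γ` lists the types of the abstractions in whose scope the expression stands.
Complete expressions have `Γ = []`. -/
inductive Tm (A : Alphabet.{u, v, w, z}) (M : List (Ty A.B) → Ty A.B → Type m) :
    List (Ty A.B) → Ty A.B → Type (max u v w m)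
  | bvar {Γ : List (Ty A.B)} {t : Ty A.B} (x : Var Γ t) : Tm A M Γ t
  | fvar {Γ : List (Ty A.B)} {t : Ty A.B} (x : A.X t) : Tm A M Γ t
  | abs {Γ : List (Ty A.B)} {s t : Ty A.B} (b : Tm A M (s :: Γ) t) : Tm A M Γ (.arr s t)
  | fn {Γ : List (Ty A.B)} {ss : List (Ty A.B)} {s : Ty A.B} (f : A.F ss s)
      (args : ∀ t, Var ss t → Tm A M Γ t) : Tm A M Γ s
  | mv {Γ : List (Ty A.B)} {ss : List (Ty A.B)} {s : Ty A.B} (Y : M ss s)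
      (args : ∀ t, Var ss t → Tm A M Γ t) : Tm A M Γ s

/-- Metaterms in the scope of `Γ`. -/
abbrev MetaTm (A : Alphabet.{u, v, w, z}) := Tm A A.Z

/-- Metaterms without metavariables, in the scope of `Γ`. -/
abbrev PureTm (A : Alphabet.{u, v, w, z}) := Tm A (fun _ _ => Empty)

/-- The terms of type `t`. -/
abbrev Term (A : Alphabet.{u, v, w, z}) (t : Ty A.B) := PureTm A [] t

/-- A family of terms in the scope of `Δ`, one for each place of `Γ`: the argument sequence of
a symbol with argument types `Γ`, or a simultaneous substitution for the variables in `Γ`. -/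
abbrev Env (A : Alphabet.{u, v, w, z}) (M : List (Ty A.B) → Ty A.B → Type m)
    (Γ Δ : List (Ty A.B)) :=
  ∀ t, Var Γ t → Tm A M Δ t

/-- Function symbols with their types. -/
abbrev Sym (A : Alphabet.{u, v, w, z}) := Σ (ss : List (Ty A.B)) (s : Ty A.B), A.F ss s

section Operations

variable {A : Alphabet.{u, v, w, z}} {M : List (Ty A.B) → Ty A.B → Type m}

/-- Extend a family by a value at the new first place. -/
def consFam {T : Type u} {P : T → Type v} {s : T} {Γ : List T} (a : P s)
    (e : ∀ t, Var Γ t → P t) : ∀ t, Var (s :: Γ) t → P t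
  | _, .zero => a
  | _, .succ x => e _ x

/-- The empty family. -/
def nilFam {T : Type u} {P : T → Type v} : ∀ t, Var ([] : List T) t → P t :=
  fun _ x => nomatch x

/-- Concatenation of two families. -/
def appendFam {T : Type u} {P : T → Type v} : {Γ Δ : List T} →
    (∀ t, Var Γ t → P t) → (∀ t, Var Δ t → P t) → ∀ t, Var (Γ ++ Δ) t → P t
  | [], _, _, e => e
  | _ :: _, _, d, e => consFam (d _ .zero) (appendFam (fun t x => d t (.succ x)) e)

/-- Inclusion of `Γ` into `Γ ++ Δ`. -/
def Var.inl {T : Type u} {t : T} (Δ : List T) : {Γ : List T} → Var Γ t → Var (Γ ++ Δ) t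
  | _, .zero => .zero
  | _, .succ x => .succ (Var.inl Δ x)

/-- Inclusion of `Δ` into `Γ ++ Δ`. -/
def Var.inr {T : Type u} {t : T} {Δ : List T} : (Γ : List T) → Var Δ t → Var (Γ ++ Δ) t
  | [], x => x
  | _ :: Γ, x => .succ (Var.inr Γ x)

/-- Renaming of the indices. -/
def Tm.rename : {Γ Δ : List (Ty A.B)} → {t : Ty A.B} → Tm A M Γ t →
    (∀ s, Var Γ s → Var Δ s) → Tm A M Δ t
  | _, _, _, .bvar x, r => .bvar (r _ x)
  | _, _, _, .fvar x, _ => .fvar x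
  | _, _, _, .abs b, r => .abs (b.rename (consFam .zero (fun s x => .succ (r s x))))
  | _, _, _, .fn f us, r => .fn f (fun t i => (us t i).rename r)
  | _, _, _, .mv Y us, r => .mv Y (fun t i => (us t i).rename r)

/-- A complete expression, regarded in the scope of `Δ`. -/
def Tm.weaken {t : Ty A.B} (a : Tm A M [] t) (Δ : List (Ty A.B)) : Tm A M Δ t :=
  a.rename nilFam

/-- Capture-avoiding simultaneous substitution for the indices. -/
def Tm.subst : {Γ Δ : List (Ty A.B)} → {t : Ty A.B} → Tm A M Γ t → Env A M Γ Δ → Tm A M Δ t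
  | _, _, _, .bvar x, e => e _ x
  | _, _, _, .fvar x, _ => .fvar x
  | _, _, _, .abs b, e =>
      .abs (b.subst (consFam (.bvar .zero) (fun s x => (e s x).rename (fun _ y => .succ y))))
  | _, _, _, .fn f us, e => .fn f (fun t i => (us t i).subst e)
  | _, _, _, .mv Y us, e => .mv Y (fun t i => (us t i).subst e)

/-- The index `x` occurs free in the expression. -/
def Tm.FreeIn : {Γ : List (Ty A.B)} → {t : Ty A.B} → (Σ s, Var Γ s) → Tm A M Γ t → Prop
  | _, t, x, .bvar y => x = ⟨t, y⟩
  | _, _, _, .fvar _ => False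
  | _, _, x, .abs b => b.FreeIn ⟨x.1, .succ x.2⟩
  | _, _, x, .fn _ us => ∃ t i, (us t i).FreeIn x
  | _, _, x, .mv _ us => ∃ t i, (us t i).FreeIn x

/-- No named variable occurs. For a complete expression: it has no free variable. -/
def Tm.Closed : {Γ : List (Ty A.B)} → {t : Ty A.B} → Tm A M Γ t → Prop
  | _, _, .bvar _ => True
  | _, _, .fvar _ => False
  | _, _, .abs b => b.Closed
  | _, _, .fn _ us => ∀ t i, (us t i).Closed
  | _, _, .mv _ us => ∀ t i, (us t i).Closed

/-- The metavariables that occur in a metaterm. -/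
def Tm.mvars : {Γ : List (Ty A.B)} → {t : Ty A.B} → Tm A M Γ t →
    Set (Σ (ss : List (Ty A.B)) (s : Ty A.B), M ss s)
  | _, _, .bvar _ => ∅
  | _, _, .fvar _ => ∅
  | _, _, .abs b => b.mvars
  | _, _, .fn _ us => {Y | ∃ t i, Y ∈ (us t i).mvars}
  | _, _, .mv Y us => {⟨_, _, Y⟩} ∪ {W | ∃ t i, W ∈ (us t i).mvars}

/-- The function symbols that occur in a metaterm. -/
def Tm.syms : {Γ : List (Ty A.B)} → {t : Ty A.B} → Tm A M Γ t → Set (Sym A)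
  | _, _, .bvar _ => ∅
  | _, _, .fvar _ => ∅
  | _, _, .abs b => b.syms
  | _, _, .fn f us => {⟨_, _, f⟩} ∪ {g | ∃ t i, g ∈ (us t i).syms}
  | _, _, .mv _ us => {g | ∃ t i, g ∈ (us t i).syms}

/-- A sequence of pairwise distinct bound variables. -/
def DistinctVars {ss Γ : List (Ty A.B)} (y : ∀ t, Var ss t → Var Γ t) : Prop :=
  ∀ t, Function.Injective (y t)

/-- Every metavariable is applied to a sequence of distinct bound variables. -/
def Tm.IsPattern : {Γ : List (Ty A.B)} → {t : Ty A.B} → Tm A M Γ t → Prop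
  | _, _, .bvar _ => True
  | _, _, .fvar _ => True
  | _, _, .abs b => b.IsPattern
  | _, _, .fn _ us => ∀ t i, (us t i).IsPattern
  | Γ, _, .mv (ss := ss) _ us =>
      ∃ y : ∀ t, Var ss t → Var Γ t, DistinctVars y ∧ us = fun t i => .bvar (y t i)

/-- The list of the arguments of a symbol, in their order. -/
def argList : {ss Γ : List (Ty A.B)} → Env A M ss Γ → List (Σ t, Tm A M Γ t)
  | [], _, _ => []
  | s :: _, _, us => ⟨s, us s .zero⟩ :: argList (fun t i => us t (.succ i))

end Operations

section Rewriting

variable {A : Alphabet.{u, v, w, z}}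

/-- A rewrite rule `head(args) → rhs`. -/
structure Rule (A : Alphabet.{u, v, w, z}) where
  dom : List (Ty A.B)
  ty : Ty A.B
  head : A.F dom ty
  args : Env A A.Z dom []
  rhs : MetaTm A [] ty
  pattern : (Tm.fn head args).IsPattern
  mvars_rhs : rhs.mvars ⊆ (Tm.fn head args).mvars
  closed_lhs : (Tm.fn head args).Closed
  closed_rhs : rhs.Closed

/-- The left-hand side. -/
def Rule.lhs (ρ : Rule A) : MetaTm A [] ρ.ty := .fn ρ.head ρ.args

/-- The head symbol of the left-hand side. -/
def Rule.sym (ρ : Rule A) : Sym A := ⟨ρ.dom, ρ.ty, ρ.head⟩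

/-- A valuation maps each metavariable to a substitute `λ(x₁, …, xₙ). a`, where `a` is a term
in the scope of the `xᵢ` and of the ambient abstractions `Γ`. -/
abbrev Valuation (A : Alphabet.{u, v, w, z}) (Γ : List (Ty A.B)) :=
  ∀ ss s, A.Z ss s → PureTm A (ss ++ Γ) s

/-- Application of a valuation to a metaterm. The variables in `Δ` are those bound in the
metaterm itself, and the substitutes cannot capture them. -/
def Tm.val {Γ : List (Ty A.B)} (σ : Valuation A Γ) : {Δ : List (Ty A.B)} → {t : Ty A.B} →
    MetaTm A Δ t → PureTm A (Δ ++ Γ) t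
  | _, _, .bvar x => .bvar (x.inl Γ)
  | _, _, .fvar x => .fvar x
  | _, _, .abs b => .abs (b.val σ)
  | _, _, .fn f us => .fn f (fun t i => (us t i).val σ)
  | Δ, _, .mv Y us =>
      (σ _ _ Y).subst (appendFam (fun t i => (us t i).val σ) (fun _ x => .bvar (x.inr Δ)))

/-- The rewrite relation: closure under abstractions and function symbols of the pairs
`(l σ, r σ)`. -/
inductive Step (R : Set (Rule A)) :
    {Γ : List (Ty A.B)} → {t : Ty A.B} → PureTm A Γ t → PureTm A Γ t → Prop
  | rule {Γ : List (Ty A.B)} (ρ : Rule A) (hρ : ρ ∈ R) (σ : Valuation A Γ) :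
      Step R (Γ := Γ) (ρ.lhs.val σ) (ρ.rhs.val σ)
  | abs {Γ : List (Ty A.B)} {s t : Ty A.B} {a b : PureTm A (s :: Γ) t} (h : Step R a b) :
      Step R (Tm.abs a) (Tm.abs b)
  | arg {Γ ss : List (Ty A.B)} {s t : Ty A.B} (f : A.F ss s) {us vs : Env A _ ss Γ}
      (i : Var ss t) (h : Step R (us t i) (vs t i))
      (he : ∀ t₁ (j : Var ss t₁), (⟨t₁, j⟩ : Σ t, Var ss t) ≠ ⟨t, i⟩ → us t₁ j = vs t₁ j) :
      Step R (Tm.fn f us) (Tm.fn f vs)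

/-- The rewrite relation is strongly normalizing: it is well-founded on the terms of each type. -/
def StronglyNormalizing (R : Set (Rule A)) : Prop :=
  ∀ t : Ty A.B, WellFounded (fun b a : Term A t => Step R a b)

/-- A choice of application symbols `@_{s,t}`. -/
abbrev AppSyms (A : Alphabet.{u, v, w, z}) := ∀ s t : Ty A.B, A.F [.arr s t, s] t

variable {M : List (Ty A.B) → Ty A.B → Type m}

/-- `@(a, b)` -/
def Tm.app (ap : AppSyms A) {Γ : List (Ty A.B)} {s t : Ty A.B} (a : Tm A M Γ (.arr s t))
    (b : Tm A M Γ s) : Tm A M Γ t :=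
  .fn (ap s t) (consFam (P := Tm A M Γ) a (consFam (P := Tm A M Γ) b nilFam))

/-- `@(… @(@(a, u₁), u₂) …, uₙ)` -/
def Tm.apps (ap : AppSyms A) {Γ : List (Ty A.B)} {t : Ty A.B} : {ss : List (Ty A.B)} →
    Tm A M Γ (Ty.arrows ss t) → Env A M ss Γ → Tm A M Γ t
  | [], a, _ => a
  | s :: _, a, us => Tm.apps ap (Tm.app ap a (us s .zero)) (fun r i => us r (.succ i))

/-- The rule `@([x]Y(x), Y₀) → Y(Y₀)`. -/
def betaRule (ap : AppSyms A) {s t : Ty A.B} (Y : A.Z [s] t) (Y₀ : A.Z [] s) : Rule A where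
  dom := [.arr s t, s]
  ty := t
  head := ap s t
  args := consFam (P := MetaTm A []) (.abs (.mv Y (fun _ i => .bvar i)))
    (consFam (P := MetaTm A []) (.mv Y₀ nilFam) nilFam)
  rhs := .mv Y (consFam (P := MetaTm A []) (.mv Y₀ nilFam) nilFam)
  pattern := by
    intro r i
    cases i with
    | zero => exact ⟨fun _ i => i, fun _ _ _ h => h, rfl⟩
    | succ i =>
      cases i with
      | zero =>
        refine ⟨nilFam, fun r x => (nomatch x), ?_⟩
        funext r x
        exact nomatch x
      | succ i => exact nomatch i
  mvars_rhs := by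
    rintro W (hW | ⟨r, i, hW⟩)
    · exact ⟨_, .zero, Or.inl hW⟩
    · cases i with
      | zero => exact ⟨_, .succ .zero, hW⟩
      | succ i => exact nomatch i
  closed_lhs := by
    intro r i
    cases i with
    | zero => exact fun _ _ => trivial
    | succ i =>
      cases i with
      | zero => exact fun _ x => nomatch x
      | succ i => exact nomatch i
  closed_rhs := by
    intro r i
    cases i with
    | zero => exact fun _ x => nomatch x
    | succ i => exact nomatch i

/-- The system `R` is a `β`-IDTS with application symbols `ap`: it contains a `β`-rule for each
pair of types, and every rule for an application symbol is (up to the names of its two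
metavariables) that rule. -/
structure IsBetaIDTS (R : Set (Rule A)) (ap : AppSyms A) : Prop where
  beta_mem : ∀ s t : Ty A.B, ∃ (Y : A.Z [s] t) (Y₀ : A.Z [] s), betaRule ap Y Y₀ ∈ R
  beta_only : ∀ ρ ∈ R, ∀ s t : Ty A.B, ρ.sym = ⟨_, _, ap s t⟩ →
    ∃ (Y : A.Z [s] t) (Y₀ : A.Z [] s), ρ = betaRule ap Y Y₀

end Rewriting

section Schema

variable {A : Alphabet.{u, v, w, z}} {M : List (Ty A.B) → Ty A.B → Type m}

/-- A choice of constructors: for each base type `b`, a set of function symbols with result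
type `b`. -/
abbrev Constructors (A : Alphabet.{u, v, w, z}) := ∀ (b : A.B) (ss : List (Ty A.B)),
  Set (A.F ss (.base b))

/-- `t` depends on `s`: `s` occurs in the type of an argument of a constructor of `t`. -/
def BDep (C : Constructors A) (t s : A.B) : Prop :=
  ∃ ss, ∃ c : A.F ss (.base t), c ∈ C t ss ∧ ∃ a ∈ ss, Ty.Occurs s a

/-- `s ≤ t` on base types: `t` depends on `s` in zero or more steps. -/
def BLe (C : Constructors A) (s t : A.B) : Prop := Relation.ReflTransGen (BDep C) t s

/-- `s = t` on base types (equivalence). -/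
def BEq (C : Constructors A) (s t : A.B) : Prop := BLe C s t ∧ BLe C t s

/-- `s < t` on base types. -/
def BLt (C : Constructors A) (s t : A.B) : Prop := BLe C s t ∧ ¬ BLe C t s

/-- A constructor of `b` with argument types `ss` is positive: base types equivalent to `b` occur
only at positive positions of the argument types. -/
def PositiveCtor (C : Constructors A) (b : A.B) (ss : List (Ty A.B)) : Prop :=
  ∀ a ∈ ss, ∀ t, BEq C t b → ¬ Ty.OccursAt false t a

/-- A constructor of `b` with argument types `ss` is basic: it is positive and has no functional
argument. -/
def BasicCtor (C : Constructors A) (b : A.B) (ss : List (Ty A.B)) : Prop :=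
  PositiveCtor C b ss ∧ ∀ a ∈ ss, ∃ d : A.B, a = .base d

/-- The base type `b` is basic: the constructors of `b` and of all base types that `b` depends on
(in any number of steps) are basic. -/
def BasicType (C : Constructors A) (b : A.B) : Prop :=
  ∀ d, BLe C d b → ∀ ss, ∀ c ∈ C d ss, BasicCtor C d ss

/-- The accessible subterms of `v`. As `v` is complete, the variables that are free in an
accessible subterm but not in `v` are exactly the indices (`bvar`). -/
inductive Accessible (C : Constructors A) (ap : AppSyms A) {r : Ty A.B} (v : Tm A M [] r) :
    {Δ : List (Ty A.B)} → {t : Ty A.B} → Tm A M Δ t → Prop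
  | self : Accessible C ap v v
  | abs {Δ : List (Ty A.B)} {s t : Ty A.B} {a : Tm A M (s :: Δ) t}
      (h : Accessible C ap v (.abs a)) : Accessible C ap v a
  | ctor {Δ ss : List (Ty A.B)} {b : A.B} {c : A.F ss (.base b)} (hc : c ∈ C b ss)
      {us : Env A M ss Δ} (h : Accessible C ap v (.fn c us)) (t : Ty A.B) (i : Var ss t) :
      Accessible C ap v (us t i)
  | basic {Δ ss : List (Ty A.B)} {s : Ty A.B} {f : A.F ss s} {us : Env A M ss Δ}
      (h : Accessible C ap v (.fn f us)) {b : A.B} (hb : BasicType C b)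
      (i : Var ss (.base b)) : Accessible C ap v (us (.base b) i)
  | appVar {Δ : List (Ty A.B)} {s t : Ty A.B} {a : Tm A M Δ (.arr s t)} {x : Var Δ s}
      (h : Accessible C ap v (Tm.app ap a (.bvar x))) (hx : ¬ a.FreeIn ⟨s, x⟩) :
      Accessible C ap v a
  | varApps {Δ ss : List (Ty A.B)} {s : Ty A.B} {x : Var Δ (Ty.arrows ss s)}
      {us : Env A M ss Δ} (h : Accessible C ap v (Tm.apps ap (.bvar x) us))
      (hx : ∀ t i, ¬ (us t i).FreeIn ⟨_, x⟩) (t : Ty A.B) (i : Var ss t) :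
      Accessible C ap v (us t i)

/-- The metavariable `Y` is accessible in one of the metaterms `ls`. -/
def AccessibleMV (C : Constructors A) (ap : AppSyms A) {ls : List (Ty A.B)} (l : Env A M ls [])
    {ss : List (Ty A.B)} {s : Ty A.B} (Y : M ss s) : Prop :=
  ∃ (r : Ty A.B) (i : Var ls r) (Δ : List (Ty A.B)) (y : ∀ t, Var ss t → Var Δ t),
    DistinctVars y ∧ Accessible C ap (l r i) (Tm.mv Y (fun t j => Tm.bvar (y t j)))

/-- `a` is a subterm of `b` at a position above which there are only function symbols. -/
inductive FunSubterm {Γ : List (Ty A.B)} {s : Ty A.B} (a : Tm A M Γ s) :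
    {t : Ty A.B} → Tm A M Γ t → Prop
  | self : FunSubterm a a
  | arg {ss : List (Ty A.B)} {r t : Ty A.B} (f : A.F ss r) (us : Env A M ss Γ) (i : Var ss t)
      (h : FunSubterm a (us t i)) : FunSubterm a (.fn f us)

/-- Covered-subterm ordering: `b = [x₁]…[xₖ]d` and `a = [x₁]…[xₖ]e`, where `e` is a subterm of
`d` at a position above which (in `d`) there are only function symbols. -/
inductive Covered : {Γ : List (Ty A.B)} → {s t : Ty A.B} → Tm A M Γ s → Tm A M Γ t → Prop
  | base {Γ : List (Ty A.B)} {s t : Ty A.B} {a : Tm A M Γ s} {b : Tm A M Γ t}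
      (h : FunSubterm a b) : Covered a b
  | abs {Γ : List (Ty A.B)} {r s t : Ty A.B} {a : Tm A M (r :: Γ) s} {b : Tm A M (r :: Γ) t}
      (h : Covered a b) : Covered (.abs a) (.abs b)

/-- Strict covered-subterm ordering, on terms of any type. -/
def CoveredLt {Γ : List (Ty A.B)} (a b : Σ t, Tm A M Γ t) : Prop := Covered a.2 b.2 ∧ a ≠ b

/-- The multiset extension of a strict ordering. -/
def MulLt {α : Type u} (r : α → α → Prop) (N P : Multiset α) : Prop :=
  ∃ K N₁ P₁ : Multiset α, N = K + N₁ ∧ P = K + P₁ ∧ P₁ ≠ 0 ∧ ∀ a ∈ N₁, ∃ b ∈ P₁, r a b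

/-- A status: a lexicographic combination of groups of argument positions (counted from `0`), each
group being compared by the multiset extension. The multiset status is `[Set.univ]`, the
lexicographic status for `n` arguments is `[{0}, …, {n - 1}]`. -/
abbrev Status := List (Set ℕ)

open Classical in
/-- The multiset of the entries of a list at the positions in `G`. -/
noncomputable def select {α : Type u} (G : Set ℕ) (l : List α) : Multiset α :=
  ((l.zipIdx.filter (fun p => decide (p.2 ∈ G))).map Prod.fst : List α)

/-- The strict extension of `r` to sequences, according to a status. -/
def StatLt {α : Type u} (r : α → α → Prop) : Status → List α → List α → Prop
  | [], _, _ => False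
  | G :: st, k, l => MulLt r (select G k) (select G l) ∨
      (select G k = select G l ∧ StatLt r st k l)

/-- `g` depends on `f`: `f` occurs in the right-hand side of a rule that defines `g`. -/
def FDep (R : Set (Rule A)) (g f : Sym A) : Prop := ∃ ρ ∈ R, ρ.sym = g ∧ f ∈ ρ.rhs.syms

/-- `f ≤ g` on function symbols: `g` depends on `f` in zero or more steps. -/
def FLe (R : Set (Rule A)) (f g : Sym A) : Prop := Relation.ReflTransGen (FDep R) g f

/-- `f = g` on function symbols (equivalence). -/
def FEq (R : Set (Rule A)) (f g : Sym A) : Prop := FLe R f g ∧ FLe R g f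

/-- `f < g` on function symbols. -/
def FLt (R : Set (Rule A)) (f g : Sym A) : Prop := FLe R f g ∧ ¬ FLe R g f

/-- The computable closure of `f(l)`. The index list `Δ` records the variables over which one
can still abstract. -/
inductive CC (R : Set (Rule A)) (ap : AppSyms A) (C : Constructors A) (stat : Sym A → Status)
    {ls : List (Ty A.B)} {lt : Ty A.B} (f : A.F ls lt) (l : Env A A.Z ls []) :
    {Δ : List (Ty A.B)} → {t : Ty A.B} → MetaTm A Δ t → Prop
  | mv {Δ ss : List (Ty A.B)} {s : Ty A.B} (Y : A.Z ss s) (hY : AccessibleMV C ap l Y)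
      (us : Env A A.Z ss Δ) (hu : ∀ t i, CC R ap C stat f l (us t i)) :
      CC R ap C stat f l (.mv Y us)
  | bvar {Δ : List (Ty A.B)} {t : Ty A.B} (x : Var Δ t) : CC R ap C stat f l (.bvar x)
  | fvar {Δ : List (Ty A.B)} {t : Ty A.B} (x : A.X t) :
      CC R ap C stat f l (.fvar x : MetaTm A Δ t)
  | ctor {Δ ss : List (Ty A.B)} {b : A.B} (c : A.F ss (.base b)) (hc : c ∈ C b ss)
      (us : Env A A.Z ss Δ) (hu : ∀ t i, CC R ap C stat f l (us t i)) :
      CC R ap C stat f l (.fn c us)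
  | app {Δ : List (Ty A.B)} {s t : Ty A.B} {a : MetaTm A Δ (.arr s t)} {b : MetaTm A Δ s}
      (ha : CC R ap C stat f l a) (hb : CC R ap C stat f l b) :
      CC R ap C stat f l (Tm.app ap a b)
  | abs {Δ : List (Ty A.B)} {s t : Ty A.B} {a : MetaTm A (s :: Δ) t}
      (ha : CC R ap C stat f l a) : CC R ap C stat f l (.abs a)
  | lower {Δ ss : List (Ty A.B)} {s : Ty A.B} (h : A.F ss s)
      (hh : FLt R ⟨_, _, h⟩ ⟨_, _, f⟩) (us : Env A A.Z ss Δ)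
      (hu : ∀ t i, CC R ap C stat f l (us t i)) : CC R ap C stat f l (.fn h us)
  | equiv {Δ ss : List (Ty A.B)} {s : Ty A.B} (g : A.F ss s)
      (hg : FEq R ⟨_, _, g⟩ ⟨_, _, f⟩) (hss : ss ≠ []) (us : Env A A.Z ss Δ)
      (hu : ∀ t i, CC R ap C stat f l (us t i))
      (hlt : StatLt CoveredLt (stat ⟨_, _, f⟩) (argList us)
        (argList (fun t i => (l t i).weaken Δ))) : CC R ap C stat f l (.fn g us)

/-- The rule follows the General Schema. -/
def GeneralSchema (R : Set (Rule A)) (ap : AppSyms A) (C : Constructors A)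
    (stat : Sym A → Status) (ρ : Rule A) : Prop :=
  CC R ap C stat ρ.head ρ.args ρ.rhs

/-- The standing assumptions on constructors, precedences and statuses. -/
structure Assumptions (R : Set (Rule A)) (C : Constructors A) (stat : Sym A → Status) :
    Prop where
  positive : ∀ b ss, ∀ c ∈ C b ss, PositiveCtor C b ss
  head_not_ctor : ∀ ρ ∈ R, ∀ b ss, ∀ c ∈ C b ss, ρ.sym ≠ ⟨ss, .base b, c⟩
  wf_base : WellFounded (BLt C)
  wf_sym : WellFounded (FLt R)
  stat_eq : ∀ f g, FEq R f g → stat f = stat g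

end Schema

end IDTS

namespace IDTS

universe u v w z m

/-! The proof is a Tait–Girard computability argument in Kripke style. A term of arrow type is
computable if it maps computable arguments, in every extension of the current scope, to computable
results. A term of base type `b` is computable if it is good (strongly normalizing, with a side
condition described below) and, whenever it reduces to a constructor of `b` applied to arguments,
these arguments are computable. This is a recursive specification. Base types strictly below `b` are
handled by well-founded recursion. Those equivalent to `b` occur only positively, so the defining
operator is monotone in them and has a fixpoint (`exists_fixpoint`, `exists_isInterp`). Only the
fixpoint equation is used afterwards.

The usual properties follow: computable terms are good, computability is closed under reduction, and
a term that is neither an abstraction, nor headed by a constructor, nor an index applied to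
arguments is computable once it is locally good and its reducts are computable (`comp_step`,
`comp_good_and_of_steps`).

The delicate point is accessibility: from computability of the arguments of a left-hand side, that
of the substitutes of the accessible metavariables must follow (`comp_of_accessible`). The clause
extracting `uᵢ` from `@(x, u₁, …, uₙ)` is out of reach of plain strong normalization, which says
nothing about computability of the `uᵢ`. Therefore every bound index carries a label, a condition on
the arguments it may receive; a world is a choice of labels, and goodness includes that the labels
are respected by all reducts, at positions not below abstractions. For a fresh index labelled "my
arguments are computable", `x` is itself computable, hence so is the application, and goodness of
the application returns computability of the `uᵢ` (`exists_fresh`). Passing back to the old world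
requires that embeddings of worlds reflect computability, which is where amalgamation enters
(`stable_comp`).

It remains that `f(us)` is computable for computable `us` (`comp_fn`). The induction is on the
precedence and then on the ordinal ranks of the arguments, compared by the status. The rank combines
reduction with passage to covered subterms (`SN.acc_descends`) and is invariant under injective
renamings, so arguments in different scopes can be compared. Root steps are treated by induction on
the computable closure (`comp_of_cc`). The identity substitution in the adequacy lemma `comp_subst`
concludes. -/

/-- Renamings of the indices of `Γ` to those of `Δ`. -/
abbrev Ren {T : Type u} (Γ Δ : List T) := ∀ s, Var Γ s → Var Δ s

/-- A renaming is injective. -/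
abbrev Ren.Inj {T : Type u} {Γ Δ : List T} (r : Ren Γ Δ) : Prop := ∀ t, Function.Injective (r t)

/-- The extension of a renaming to the scope of one more abstraction. -/
abbrev Ren.lift {T : Type u} {Γ Δ : List T} {s : T} (r : Ren Γ Δ) : Ren (s :: Γ) (s :: Δ) :=
  consFam (P := fun t => Var (s :: Δ) t) .zero (fun t x => .succ (r t x))

/-! ### Families indexed by variables, and injective renamings -/

section Families

variable {T : Type u} {P : T → Type v}

@[simp] theorem consFam_zero {s : T} {Γ : List T} (a : P s) (e : ∀ t, Var Γ t → P t) :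
    consFam a e s .zero = a := rfl

@[simp] theorem consFam_succ {s t : T} {Γ : List T} (a : P s) (e : ∀ t, Var Γ t → P t)
    (x : Var Γ t) : consFam a e t (.succ x) = e t x := rfl

theorem consFam_eta {s : T} {Γ : List T} (e : ∀ t, Var (s :: Γ) t → P t) :
    consFam (e s .zero) (fun t x => e t (.succ x)) = e := by
  funext t x; cases x <;> rfl

theorem nilFam_eq (e : ∀ t, Var ([] : List T) t → P t) : e = nilFam := by
  funext t x; exact nomatch x

theorem map_consFam {Q : T → Type w} (f : ∀ t, P t → Q t) {s : T} {Γ : List T} (a : P s)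
    (e : ∀ t, Var Γ t → P t) :
    (fun t x => f t (consFam a e t x)) = consFam (f s a) (fun t x => f t (e t x)) := by
  funext t x; cases x <;> rfl

@[simp] theorem appendFam_inl {Γ Δ : List T} (d : ∀ t, Var Γ t → P t) (e : ∀ t, Var Δ t → P t)
    {t : T} (x : Var Γ t) : appendFam d e t (x.inl Δ) = d t x := by
  induction x with
  | zero => rfl
  | succ x ih => exact ih (fun t x => d t (.succ x))

@[simp] theorem appendFam_inr {Γ Δ : List T} (d : ∀ t, Var Γ t → P t) (e : ∀ t, Var Δ t → P t)
    {t : T} (x : Var Δ t) : appendFam d e t (x.inr Γ) = e t x := by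
  induction Γ with
  | nil => rfl
  | cons s Γ ih => exact ih (fun t x => d t (.succ x))

theorem Var.inl_or_inr {Γ Δ : List T} {t : T} (x : Var (Γ ++ Δ) t) :
    (∃ y : Var Γ t, x = y.inl Δ) ∨ ∃ y : Var Δ t, x = y.inr Γ := by
  induction Γ with
  | nil => exact Or.inr ⟨x, rfl⟩
  | cons s Γ ih =>
    cases x with
    | zero => exact Or.inl ⟨.zero, rfl⟩
    | succ x =>
      rcases ih x with ⟨y, rfl⟩ | ⟨y, rfl⟩
      · exact Or.inl ⟨.succ y, rfl⟩
      · exact Or.inr ⟨y, rfl⟩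

theorem map_appendFam {Q : T → Type w} (f : ∀ t, P t → Q t) {Γ Δ : List T}
    (d : ∀ t, Var Γ t → P t) (e : ∀ t, Var Δ t → P t) :
    (fun t x => f t (appendFam d e t x)) =
      appendFam (fun t x => f t (d t x)) (fun t x => f t (e t x)) := by
  funext t x
  rcases x.inl_or_inr with ⟨y, rfl⟩ | ⟨y, rfl⟩ <;> simp

theorem appendFam_inl_inr {Γ Δ : List T} (e : ∀ t, Var (Γ ++ Δ) t → P t) :
    appendFam (fun t x => e t (x.inl Δ)) (fun t x => e t (x.inr Γ)) = e := by
  funext t x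
  rcases x.inl_or_inr with ⟨y, rfl⟩ | ⟨y, rfl⟩ <;> simp

theorem Var.inl_injective {Γ : List T} (Δ : List T) {t : T} :
    Function.Injective (fun x : Var Γ t => x.inl Δ) := by
  intro x
  induction x with
  | zero => intro y h; cases y with
    | zero => rfl
    | succ y => cases h
  | succ x ih => intro y h; cases y with
    | zero => cases h
    | succ y => exact congrArg _ (ih (by simpa [Var.inl] using h))

theorem Var.inr_injective (Γ : List T) {Δ : List T} {t : T} :
    Function.Injective (fun x : Var Δ t => x.inr Γ) := by
  induction Γ with
  | nil => exact fun _ _ h => h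
  | cons s Γ ih => intro x y h; exact ih (by simpa [Var.inr] using h)

theorem Var.inl_ne_inr {Γ Δ : List T} {t : T} (x : Var Γ t) (y : Var Δ t) :
    x.inl Δ ≠ y.inr Γ := by
  induction x with
  | zero => intro h; cases h
  | succ x ih => intro h; exact ih y (by simpa [Var.inl, Var.inr] using h)

theorem Ren.Inj.lift {Γ Δ : List T} {s : T} {r : Ren Γ Δ} (hr : r.Inj) :
    (r.lift (s := s)).Inj := by
  intro t x y h
  cases x with
  | zero => cases y with
    | zero => rfl
    | succ y => cases h
  | succ x => cases y with
    | zero => cases h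
    | succ y => exact congrArg _ (hr t (by simpa using h))

theorem Var.succ_inj_ren {Γ : List T} {s : T} :
    Ren.Inj (fun t (x : Var Γ t) => (Var.succ x : Var (s :: Γ) t)) :=
  fun t x y h => by simpa using h

theorem Var.succ_ne_zero {Γ : List T} {s t : T} (x : Var Γ t) :
    (⟨t, .succ x⟩ : Σ t, Var (s :: Γ) t) ≠ ⟨s, .zero⟩ := by
  intro h
  obtain ⟨rfl, h⟩ := Sigma.mk.inj h
  cases eq_of_heq h

theorem Var.mem {Γ : List T} {t : T} (x : Var Γ t) : t ∈ Γ := by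
  induction x with
  | zero => exact List.mem_cons_self
  | succ x ih => exact List.mem_cons_of_mem _ ih

end Families

/-! ### Algebra of renamings and substitutions -/

section Substitution

variable {A : Alphabet.{u, v, w, z}} {M : List (Ty A.B) → Ty A.B → Type m}
variable {Γ Δ Θ : List (Ty A.B)} {s t : Ty A.B}

/-- The extension of a substitution to the scope of one more abstraction. -/
abbrev Env.lift (e : Env A M Γ Δ) : Env A M (s :: Γ) (s :: Δ) :=
  consFam (P := Tm A M (s :: Δ)) (.bvar .zero) (fun t x => (e t x).rename (fun _ y => .succ y))

/-- A renaming, as a substitution. -/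
abbrev Ren.env (r : Ren Γ Δ) : Env A M Γ Δ := fun t x => .bvar (r t x)

@[simp] theorem Tm.subst_bvar (x : Var Γ t) (e : Env A M Γ Δ) :
    (Tm.bvar x : Tm A M Γ t).subst e = e t x := rfl
@[simp] theorem Tm.subst_fvar (x : A.X t) (e : Env A M Γ Δ) :
    (Tm.fvar x : Tm A M Γ t).subst e = .fvar x := rfl
@[simp] theorem Tm.subst_abs (b : Tm A M (s :: Γ) t) (e : Env A M Γ Δ) :
    (Tm.abs b).subst e = .abs (b.subst e.lift) := rfl
@[simp] theorem Tm.subst_fn {ss : List (Ty A.B)} (f : A.F ss t) (us : Env A M ss Γ)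
    (e : Env A M Γ Δ) : (Tm.fn f us).subst e = .fn f (fun t i => (us t i).subst e) := rfl
@[simp] theorem Tm.subst_mv {ss : List (Ty A.B)} (Y : M ss t) (us : Env A M ss Γ)
    (e : Env A M Γ Δ) : (Tm.mv Y us).subst e = .mv Y (fun t i => (us t i).subst e) := rfl
@[simp] theorem Tm.rename_bvar (x : Var Γ t) (r : Ren Γ Δ) :
    (Tm.bvar x : Tm A M Γ t).rename r = .bvar (r t x) := rfl
@[simp] theorem Tm.rename_fvar (x : A.X t) (r : Ren Γ Δ) :
    (Tm.fvar x : Tm A M Γ t).rename r = .fvar x := rfl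
@[simp] theorem Tm.rename_abs (b : Tm A M (s :: Γ) t) (r : Ren Γ Δ) :
    (Tm.abs b).rename r = .abs (b.rename r.lift) := rfl
@[simp] theorem Tm.rename_fn {ss : List (Ty A.B)} (f : A.F ss t) (us : Env A M ss Γ)
    (r : Ren Γ Δ) : (Tm.fn f us).rename r = .fn f (fun t i => (us t i).rename r) := rfl
@[simp] theorem Tm.rename_mv {ss : List (Ty A.B)} (Y : M ss t) (us : Env A M ss Γ)
    (r : Ren Γ Δ) : (Tm.mv Y us).rename r = .mv Y (fun t i => (us t i).rename r) := rfl

theorem Tm.rename_eq_subst (a : Tm A M Γ t) (r : Ren Γ Δ) : a.rename r = a.subst r.env := by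
  induction a generalizing Δ with
  | bvar x => rfl
  | fvar x => rfl
  | abs b ih =>
    rw [Tm.rename_abs, Tm.subst_abs, ih]
    congr 2
    funext t x; cases x <;> rfl
  | fn f us ih => simp [ih]
  | mv Y us ih => simp [ih]

theorem Tm.rename_subst (a : Tm A M Γ t) (r : Ren Γ Δ) (e : Env A M Δ Θ) :
    (a.rename r).subst e = a.subst (fun s x => e s (r s x)) := by
  induction a generalizing Δ Θ with
  | bvar x => rfl
  | fvar x => rfl
  | abs b ih =>
    simp only [Tm.rename_abs, Tm.subst_abs, ih]
    congr 2
    funext t x; cases x <;> rfl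
  | fn f us ih => simp [ih]
  | mv Y us ih => simp [ih]

theorem Tm.rename_rename (a : Tm A M Γ t) (r : Ren Γ Δ) (q : Ren Δ Θ) :
    (a.rename r).rename q = a.rename (fun s x => q s (r s x)) := by
  rw [Tm.rename_eq_subst _ q, Tm.rename_subst, Tm.rename_eq_subst]

theorem Tm.subst_rename (a : Tm A M Γ t) (e : Env A M Γ Δ) (r : Ren Δ Θ) :
    (a.subst e).rename r = a.subst (fun s x => (e s x).rename r) := by
  induction a generalizing Δ Θ with
  | bvar x => rfl
  | fvar x => rfl
  | abs b ih =>
    simp only [Tm.rename_abs, Tm.subst_abs, ih]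
    congr 2
    funext t x
    cases x with
    | zero => rfl
    | succ x => simp only [consFam_succ, Tm.rename_rename]
  | fn f us ih => simp [ih]
  | mv Y us ih => simp [ih]

theorem Tm.subst_subst (a : Tm A M Γ t) (e : Env A M Γ Δ) (d : Env A M Δ Θ) :
    (a.subst e).subst d = a.subst (fun s x => (e s x).subst d) := by
  induction a generalizing Δ Θ with
  | bvar x => rfl
  | fvar x => rfl
  | abs b ih =>
    simp only [Tm.subst_abs, ih]
    congr 2
    funext t x
    cases x with
    | zero => rfl
    | succ x => simp only [consFam_succ, Tm.rename_subst, Tm.subst_rename]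
  | fn f us ih => simp [ih]
  | mv Y us ih => simp [ih]

theorem Tm.subst_id (a : Tm A M Γ t) : a.subst (fun _ x => .bvar x) = a := by
  induction a with
  | bvar x => rfl
  | fvar x => rfl
  | abs b ih =>
    rw [Tm.subst_abs]
    congr 1
    conv_rhs => rw [← ih]
    congr 1
    funext t x; cases x <;> rfl
  | fn f us ih => simp [ih]
  | mv Y us ih => simp [ih]

theorem Tm.rename_id (a : Tm A M Γ t) : a.rename (fun _ x => x) = a := by
  rw [Tm.rename_eq_subst]; exact a.subst_id

open Classical in
/-- A left inverse, up to free variables, of an injective renaming. -/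
noncomputable def Ren.inv (r : Ren Γ Δ) : Env A M Δ Γ := fun t y =>
  if h : ∃ x, r t x = y then .bvar h.choose
  else .fvar (Classical.choice (A.infinite_X t).nonempty)

theorem Ren.inv_apply {r : Ren Γ Δ} (hr : r.Inj) (x : Var Γ t) :
    (r.inv : Env A M Δ Γ) t (r t x) = .bvar x := by
  have h : ∃ x', r t x' = r t x := ⟨x, rfl⟩
  simp only [Ren.inv, dif_pos h]
  exact congrArg _ (hr t h.choose_spec)

theorem Tm.rename_subst_inv {r : Ren Γ Δ} (hr : r.Inj) (a : Tm A M Γ t) :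
    (a.rename r).subst r.inv = a := by
  rw [Tm.rename_subst]
  simp only [Ren.inv_apply hr]
  exact a.subst_id

theorem Tm.rename_injective {r : Ren Γ Δ} (hr : r.Inj) :
    Function.Injective (fun a : Tm A M Γ t => a.rename r) := fun a b h => by
  rw [← Tm.rename_subst_inv hr a, ← Tm.rename_subst_inv hr b]
  exact congrArg (fun c : Tm A M Δ t => c.subst r.inv) h

end Substitution

/-! ### Instances of metaterms under valuations -/

section Valuations

variable {A : Alphabet.{u, v, w, z}} {Γ Γ' Δ Θ : List (Ty A.B)} {s t : Ty A.B}

/-- The instance of a metaterm under a valuation `σ`, with `e` substituted for the indices of the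
metaterm and `d` for those of the substitutes of `σ`. -/
def Tm.inst (σ : Valuation A Γ) (a : MetaTm A Δ t) (e : Env A (fun _ _ => Empty) Δ Θ)
    (d : Env A (fun _ _ => Empty) Γ Θ) : PureTm A Θ t :=
  (a.val σ).subst (appendFam e d)

theorem Env.lift_appendFam (e : Env A (fun _ _ => Empty) Δ Θ)
    (d : Env A (fun _ _ => Empty) Γ Θ) :
    Env.lift (s := s) (appendFam (P := PureTm A Θ) e d) =
      appendFam (P := PureTm A (s :: Θ)) e.lift
        (fun t x => (d t x).rename (fun _ y => .succ y)) := by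
  funext t x
  cases x with
  | zero => rfl
  | succ x =>
    exact congrFun (congrFun (map_appendFam (P := PureTm A Θ) (Q := PureTm A (s :: Θ))
      (fun t a => a.rename (fun _ y => .succ y)) e d) t) x

variable (σ : Valuation A Γ) (e : Env A (fun _ _ => Empty) Δ Θ) (d : Env A (fun _ _ => Empty) Γ Θ)

@[simp] theorem Tm.inst_bvar (x : Var Δ t) : Tm.inst σ (.bvar x) e d = e t x :=
  appendFam_inl _ _ _
@[simp] theorem Tm.inst_fvar (x : A.X t) : Tm.inst σ (.fvar x) e d = .fvar x := rfl
@[simp] theorem Tm.inst_fn {ss : List (Ty A.B)} (f : A.F ss t) (us : Env A A.Z ss Δ) :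
    Tm.inst σ (.fn f us) e d = .fn f (fun t i => (us t i).inst σ e d) := rfl
theorem Tm.inst_abs (b : MetaTm A (s :: Δ) t) :
    Tm.inst σ (.abs b) e d =
      .abs (b.inst σ e.lift (fun t x => (d t x).rename (fun _ y => .succ y))) := by
  simp only [Tm.inst, ← Env.lift_appendFam]
  rfl
theorem Tm.inst_mv {ss : List (Ty A.B)} (Y : A.Z ss t) (us : Env A A.Z ss Δ) :
    Tm.inst σ (.mv Y us) e d =
      (σ ss t Y).subst (appendFam (fun t i => (us t i).inst σ e d) d) := by
  simp only [Tm.inst, Tm.val, Tm.subst_subst]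
  congr 1
  rw [map_appendFam (P := PureTm A (Δ ++ Γ)) (Q := PureTm A Θ)
    (fun t a => a.subst (appendFam e d))]
  simp

theorem Tm.inst_subst (a : MetaTm A Δ t) {Θ' : List (Ty A.B)}
    (c : Env A (fun _ _ => Empty) Θ Θ') :
    (a.inst σ e d).subst c = a.inst σ (fun t x => (e t x).subst c) (fun t x => (d t x).subst c) := by
  simp only [Tm.inst, Tm.subst_subst]
  congr 1
  exact map_appendFam (P := PureTm A Θ) (Q := PureTm A Θ') (fun t a => a.subst c) e d

theorem Tm.inst_rename (a : MetaTm A Δ t) {Θ' : List (Ty A.B)} (r : Ren Θ Θ') :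
    (a.inst σ e d).rename r =
      a.inst σ (fun t x => (e t x).rename r) (fun t x => (d t x).rename r) := by
  simp only [Tm.rename_eq_subst, Tm.inst_subst]

theorem Tm.inst_congr (a : MetaTm A Δ t) (e' : Env A (fun _ _ => Empty) Δ Θ)
    (h : ∀ s (x : Var Δ s), a.FreeIn ⟨s, x⟩ → e s x = e' s x) :
    a.inst σ e d = a.inst σ e' d := by
  induction a generalizing Θ with
  | bvar x => simpa using h _ x rfl
  | fvar x => rfl
  | abs b ih =>
    rw [Tm.inst_abs, Tm.inst_abs]
    congr 1
    apply ih
    intro s x hx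
    cases x with
    | zero => rfl
    | succ x => exact congrArg (fun c : PureTm A Θ s => c.rename _) (h s x hx)
  | fn f us ih =>
    simp only [Tm.inst_fn]
    congr 1
    funext t i
    exact ih t i _ _ _ (fun s x hx => h s x ⟨t, i, hx⟩)
  | mv Y us ih =>
    simp only [Tm.inst_mv]
    congr 2
    funext t i
    exact ih t i _ _ _ (fun s x hx => h s x ⟨t, i, hx⟩)

/-- The action of a substitution on a valuation. -/
def Valuation.subst (σ : Valuation A Γ) (e : Env A (fun _ _ => Empty) Γ Γ') : Valuation A Γ' :=
  fun ss s Y => (σ ss s Y).subst (appendFam (P := PureTm A (ss ++ Γ'))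
    (fun _ x => .bvar (x.inl Γ')) (fun t x => (e t x).rename (fun _ y => y.inr ss)))

/-- Acting on the substitutes first, or on the finished instance, makes no difference, because
substitutes cannot capture the indices of the metaterm. Stability of rewriting under substitution
rests on this. -/
theorem Tm.inst_valuation_subst (c : Env A (fun _ _ => Empty) Γ Γ') (a : MetaTm A Δ t)
    (d' : Env A (fun _ _ => Empty) Γ' Θ) :
    a.inst (σ.subst c) e d' = a.inst σ e (fun t x => (c t x).subst d') := by
  induction a generalizing Θ with
  | bvar x => simp
  | fvar x => rfl
  | abs b ih =>
    rw [Tm.inst_abs, Tm.inst_abs, ih]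
    simp only [Tm.subst_rename]
  | fn f us ih => simp [ih]
  | mv Y us ih =>
    simp only [Tm.inst_mv, ih, Valuation.subst, Tm.subst_subst]
    congr 1
    rw [map_appendFam (P := PureTm A _) (Q := PureTm A Θ) (fun t a => a.subst _)]
    simp only [Tm.subst_bvar, Tm.rename_subst, appendFam_inl, appendFam_inr]

theorem Tm.val_eq_inst (a : MetaTm A [] t) : a.val σ = a.inst σ nilFam (fun _ x => .bvar x) :=
  (Tm.subst_id _).symm

theorem Tm.val_valuation_subst (a : MetaTm A [] t) (c : Env A (fun _ _ => Empty) Γ Γ') :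
    a.val (σ.subst c) = (a.val σ).subst c := by
  rw [Tm.val_eq_inst, Tm.inst_valuation_subst]
  simp only [Tm.subst_id]
  rfl

theorem Tm.inst_weaken (a : MetaTm A [] t) : (a.weaken Δ).inst σ e d = (a.val σ).subst d := by
  have key : ∀ {Δ₁ Δ₂ : List (Ty A.B)} {t : Ty A.B} (a : MetaTm A Δ₁ t) (r : Ren Δ₁ Δ₂)
      {Θ : List (Ty A.B)} (e : Env A (fun _ _ => Empty) Δ₂ Θ)
      (d : Env A (fun _ _ => Empty) Γ Θ),
      (a.rename r).inst σ e d = a.inst σ (fun t x => e t (r t x)) d := by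
    intro Δ₁ Δ₂ t a
    induction a generalizing Δ₂ with
    | bvar x => intros; simp
    | fvar x => intros; rfl
    | abs b ih =>
      intro r Θ e d
      rw [Tm.rename_abs, Tm.inst_abs, Tm.inst_abs, ih]
      congr 2
      funext t x; cases x <;> rfl
    | fn f us ih => intros; simp [ih]
    | mv Y us ih => intros; simp [Tm.inst_mv, ih]
  rw [Tm.weaken, key]
  simp only [Tm.inst]
  congr 1

end Valuations

/-! ### Uniqueness of matching for patterns -/

section Matching

variable {A : Alphabet.{u, v, w, z}} {Γ Δ : List (Ty A.B)} {t : Ty A.B}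

theorem Tm.val_congr {σ σ' : Valuation A Γ} (a : MetaTm A Δ t)
    (h : ∀ Y ∈ a.mvars, σ _ _ Y.2.2 = σ' _ _ Y.2.2) : a.val σ = a.val σ' := by
  induction a with
  | bvar x => rfl
  | fvar x => rfl
  | abs b ih => exact congrArg Tm.abs (ih h)
  | fn f us ih =>
    simp only [Tm.val]
    congr 1
    funext t i
    exact ih t i fun Y hY => h Y ⟨t, i, hY⟩
  | mv Y us ih =>
    simp only [Tm.val]
    rw [h ⟨_, _, Y⟩ (Or.inl rfl)]
    congr 2
    funext t i
    exact ih t i fun Y hY => h Y (Or.inr ⟨t, i, hY⟩)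

/-- On distinct bound variables, a metavariable is instantiated by an injective renaming of its
substitute, from which the substitute can be recovered. -/
theorem Tm.IsPattern.val_injective {σ σ' : Valuation A Γ} {a : MetaTm A Δ t} (ha : a.IsPattern)
    (h : a.val σ = a.val σ') : ∀ Y ∈ a.mvars, σ _ _ Y.2.2 = σ' _ _ Y.2.2 := by
  induction a with
  | bvar x => exact fun Y hY => hY.elim
  | fvar x => exact fun Y hY => hY.elim
  | abs b ih => exact ih ha (by simpa [Tm.val] using h)
  | fn f us ih =>
    rintro Y ⟨t, i, hY⟩
    refine ih t i (ha t i) ?_ Y hY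
    simp only [Tm.val, Tm.fn.injEq, heq_eq_eq, true_and] at h
    exact congrFun (congrFun h t) i
  | @mv Δ ss s Y us ih =>
    obtain ⟨y, hy, rfl⟩ := ha
    rintro W (hW | ⟨t, i, hW⟩)
    · obtain rfl : W = ⟨_, _, Y⟩ := hW
      let r : Ren (ss ++ Γ) (Δ ++ Γ) := appendFam (P := fun t => Var (Δ ++ Γ) t)
        (fun t i => (y t i).inl Γ) (fun _ x => x.inr Δ)
      have hr : r.Inj := by
        intro t x x' hx
        rcases x.inl_or_inr with ⟨x, rfl⟩ | ⟨x, rfl⟩ <;>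
          rcases x'.inl_or_inr with ⟨x', rfl⟩ | ⟨x', rfl⟩ <;>
          simp only [r, appendFam_inl, appendFam_inr] at hx
        · rw [hy t (Var.inl_injective Γ hx)]
        · exact (Var.inl_ne_inr _ _ hx).elim
        · exact (Var.inl_ne_inr _ _ hx.symm).elim
        · rw [Var.inr_injective Δ hx]
      have key : ∀ τ : Valuation A Γ,
          (Tm.mv Y fun t i => .bvar (y t i) : MetaTm A Δ s).val τ = (τ _ _ Y).rename r := by
        intro τ
        rw [Tm.rename_eq_subst]
        simp only [Tm.val]
        congr 1
        exact (map_appendFam (P := fun t => Var (Δ ++ Γ) t) (Q := PureTm A (Δ ++ Γ))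
          (fun t x => .bvar x) _ _).symm
      rw [key, key] at h
      exact Tm.rename_injective hr h
    · exact hW.elim

end Matching

/-! ### Reduction steps: stability, inversion, reflection along renamings -/

section Steps

variable {A : Alphabet.{u, v, w, z}} {R : Set (Rule A)} {Γ Δ : List (Ty A.B)} {s t : Ty A.B}

theorem Step.subst {a b : PureTm A Γ t} (h : Step R a b) (e : Env A (fun _ _ => Empty) Γ Δ) :
    Step R (a.subst e) (b.subst e) := by
  induction h generalizing Δ with
  | @rule Γ ρ hρ σ =>
    have := Step.rule ρ hρ (σ.subst e)
    rwa [Tm.val_valuation_subst, Tm.val_valuation_subst] at this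
  | abs h ih => exact .abs (ih _)
  | arg f i h he ih =>
    exact .arg f i (ih e) fun t j hj => congrArg (fun c => Tm.subst c e) (he t j hj)

theorem Step.rename {a b : PureTm A Γ t} (h : Step R a b) (r : Ren Γ Δ) :
    Step R (a.rename r) (b.rename r) := by
  rw [Tm.rename_eq_subst, Tm.rename_eq_subst]
  exact h.subst _

/-- The type is kept general, with heterogeneous equalities, because the result type of a rule is
not syntactically an arrow and case analysis on the step would otherwise fail to unify. The usable
form is `step_abs_iff`. -/
theorem Step.abs_inv {u v : PureTm A Γ t} (h : Step R u v) {s t' : Ty A.B}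
    (ht : t = .arr s t') {a : PureTm A (s :: Γ) t'} (hu : HEq u (Tm.abs a)) :
    ∃ b, Step R a b ∧ HEq v (Tm.abs b : PureTm A Γ (.arr s t')) := by
  cases h with
  | rule ρ hρ σ =>
    obtain ⟨dom, ty, head, args, rhs, h1, h2, h3, h4⟩ := ρ
    dsimp only at ht
    subst ht
    cases eq_of_heq hu
  | abs h =>
    cases ht
    cases eq_of_heq hu
    exact ⟨_, h, HEq.rfl⟩
  | arg f i h he =>
    subst ht
    cases eq_of_heq hu

theorem step_abs_iff {a : PureTm A (s :: Γ) t} {v : PureTm A Γ (.arr s t)} :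
    Step R (.abs a) v ↔ ∃ b, Step R a b ∧ v = .abs b := by
  constructor
  · intro h
    obtain ⟨b, hb, hv⟩ := h.abs_inv rfl HEq.rfl
    exact ⟨b, hb, eq_of_heq hv⟩
  · rintro ⟨b, hb, rfl⟩
    exact .abs hb

theorem step_fn {ss : List (Ty A.B)} {f : A.F ss t} {us : Env A (fun _ _ => Empty) ss Γ}
    {v : PureTm A Γ t} (h : Step R (.fn f us) v) :
    (∃ (l : Env A A.Z ss []) (r : MetaTm A [] t) (h₁ : _) (h₂ : _) (h₃ : _) (h₄ : _)
      (σ : Valuation A Γ), (⟨ss, t, f, l, r, h₁, h₂, h₃, h₄⟩ : Rule A) ∈ R ∧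
      us = (fun t i => (l t i).val σ) ∧ v = r.val σ) ∨
    ∃ (r : Ty A.B) (i : Var ss r) (vs : Env A (fun _ _ => Empty) ss Γ),
      Step R (us r i) (vs r i) ∧
      (∀ t₁ (j : Var ss t₁), (⟨t₁, j⟩ : Σ t, Var ss t) ≠ ⟨r, i⟩ → us t₁ j = vs t₁ j) ∧
      v = .fn f vs := by
  generalize hu : Tm.fn f us = u at h
  cases h with
  | rule ρ hρ σ =>
    obtain ⟨dom, ty, head, args, rhs, h1, h2, h3, h4⟩ := ρ
    simp only [Rule.lhs, Tm.val, Tm.fn.injEq] at hu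
    obtain ⟨rfl, hf, hus⟩ := hu
    cases eq_of_heq hf
    cases eq_of_heq hus
    exact Or.inl ⟨args, rhs, h1, h2, h3, h4, σ, hρ, rfl, rfl⟩
  | abs h => cases hu
  | arg g i h he =>
    cases hu
    exact Or.inr ⟨_, i, _, h, he, rfl⟩

theorem not_step_bvar {x : Var Γ t} {v : PureTm A Γ t} : ¬ Step R (.bvar x) v := by
  intro h
  generalize hu : Tm.bvar x = u at h
  cases h with
  | rule ρ hρ σ => cases hu
  | abs h => cases hu
  | arg g i h he => cases hu

theorem not_step_fvar {x : A.X t} {v : PureTm A Γ t} : ¬ Step R (.fvar x) v := by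
  intro h
  generalize hu : Tm.fvar x = u at h
  cases h with
  | rule ρ hρ σ => cases hu
  | abs h => cases hu
  | arg g i h he => cases hu

/-- The valuation may use indices outside the image of `r`, but only at metavariables absent from
the left-hand side. Pulling it back along `r.inv` and pushing it forward again leaves the left-hand
side unchanged, hence by pattern matching all its metavariables, hence the right-hand side. -/
theorem Rule.rhs_val_eq (ρ : Rule A) {σ : Valuation A Δ} {r : Ren Γ Δ} (hr : r.Inj)
    {a : PureTm A Γ ρ.ty} (h : ρ.lhs.val σ = a.rename r) :
    a = ρ.lhs.val (σ.subst r.inv) ∧ ρ.rhs.val σ = (ρ.rhs.val (σ.subst r.inv)).rename r := by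
  have ha : a = ρ.lhs.val (σ.subst r.inv) := by
    rw [Tm.val_valuation_subst, h]
    exact (Tm.rename_subst_inv hr a).symm
  refine ⟨ha, ?_⟩
  rw [Tm.rename_eq_subst, ← Tm.val_valuation_subst]
  have key : ρ.lhs.val σ = ρ.lhs.val ((σ.subst r.inv).subst r.env) := by
    rw [Tm.val_valuation_subst, ← ha, ← Tm.rename_eq_subst, h]
  exact Tm.val_congr _ fun Y hY => Tm.IsPattern.val_injective ρ.pattern key Y (ρ.mvars_rhs hY)

/-- Enlarging the scope creates no new reductions; this makes strong normalization, goodness and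
ranks independent of the ambient scope. -/
theorem Step.rename_reflect {r : Ren Γ Δ} (hr : r.Inj) {a : PureTm A Γ t} {v : PureTm A Δ t}
    (h : Step R (a.rename r) v) : ∃ b, Step R a b ∧ v = b.rename r := by
  generalize hu : a.rename r = u at h
  induction h generalizing Γ with
  | @rule Δ ρ hρ σ =>
    obtain ⟨h1, h2⟩ := ρ.rhs_val_eq hr hu.symm
    exact ⟨ρ.rhs.val (σ.subst r.inv), h1 ▸ Step.rule ρ hρ _, h2⟩
  | abs h ih =>
    cases a with
    | abs a =>
      obtain ⟨b, hb, hv⟩ := ih hr.lift (Tm.abs.inj hu)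
      exact ⟨.abs b, .abs hb, by rw [hv]; rfl⟩
    | mv Y _ => exact Y.elim
    | _ => cases hu
  | @arg Δ ss s t f us vs i h he ih =>
    cases a with
    | @fn _ ss' _ g as =>
      simp only [Tm.rename_fn, Tm.fn.injEq] at hu
      obtain ⟨rfl, hf, hus⟩ := hu
      cases eq_of_heq hf
      cases eq_of_heq hus
      obtain ⟨b, hb, hv⟩ := ih hr rfl
      classical
      let bs : Env A (fun _ _ => Empty) ss' Γ := fun t j =>
        Function.update (β := fun p : Σ t, Var ss' t => PureTm A Γ p.1)
          (fun p => as p.1 p.2) ⟨_, i⟩ b ⟨t, j⟩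
      refine ⟨.fn g bs, .arg g i ?_ ?_, ?_⟩
      · simpa [bs] using hb
      · intro t₁ j hj
        simp only [bs]
        rw [Function.update_of_ne hj]
      · rw [Tm.rename_fn]
        congr 1
        funext t₁ j
        by_cases hj : (⟨t₁, j⟩ : Σ t, Var ss' t) = ⟨_, i⟩
        · cases hj
          simpa [bs] using hv
        · simp only [bs]
          rw [Function.update_of_ne hj]
          exact (he t₁ j hj).symm
    | mv Y _ => exact Y.elim
    | _ => cases hu

end Steps

/-! ### Application symbols and β-steps -/

section App

variable {A : Alphabet.{u, v, w, z}} {M : List (Ty A.B) → Ty A.B → Type m} (ap : AppSyms A)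
  {Γ Δ : List (Ty A.B)} {s t : Ty A.B}

theorem Tm.rename_app (a : Tm A M Γ (.arr s t)) (b : Tm A M Γ s) (r : Ren Γ Δ) :
    (Tm.app ap a b).rename r = Tm.app ap (a.rename r) (b.rename r) := by
  simp only [Tm.app, Tm.rename_fn]
  congr 1
  rw [map_consFam (P := Tm A M Γ) (Q := Tm A M Δ) (fun t c => c.rename r),
    map_consFam (P := Tm A M Γ) (Q := Tm A M Δ) (fun t c => c.rename r)]
  congr 2
  exact nilFam_eq _

theorem Tm.inst_app {Γ' : List (Ty A.B)} (σ : Valuation A Γ') (a : MetaTm A Γ (.arr s t))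
    (b : MetaTm A Γ s) (e : Env A (fun _ _ => Empty) Γ Δ) (d : Env A (fun _ _ => Empty) Γ' Δ) :
    (Tm.app ap a b).inst σ e d = Tm.app ap (a.inst σ e d) (b.inst σ e d) := by
  simp only [Tm.app, Tm.inst_fn]
  congr 1
  rw [map_consFam (P := MetaTm A Γ) (Q := PureTm A Δ) (fun t c => c.inst σ e d),
    map_consFam (P := MetaTm A Γ) (Q := PureTm A Δ) (fun t c => c.inst σ e d)]
  congr 2
  exact nilFam_eq _

variable {ap}

theorem fn_ap_eq_app (us : Env A M [.arr s t, s] Γ) :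
    Tm.fn (ap s t) us = Tm.app ap (us _ .zero) (us _ (.succ .zero)) := by
  rw [Tm.app]
  congr 1
  funext r i
  cases i with
  | zero => rfl
  | succ i => cases i with
    | zero => rfl
    | succ i => exact nomatch i

theorem Tm.app_inj {s' : Ty A.B} {a : Tm A M Γ (.arr s t)} {b : Tm A M Γ s}
    {a' : Tm A M Γ (.arr s' t)} {b' : Tm A M Γ s'} (h : Tm.app ap a b = Tm.app ap a' b') :
    s = s' ∧ HEq a a' ∧ HEq b b' := by
  simp only [Tm.app, Tm.fn.injEq, List.cons.injEq, Ty.arr.injEq, and_true, and_self] at h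
  obtain ⟨rfl, -, h⟩ := h
  have h := eq_of_heq h
  exact ⟨rfl, heq_of_eq (congrFun (congrFun h _) .zero),
    heq_of_eq (congrFun (congrFun h _) (.succ .zero))⟩

end App

section Beta

variable {A : Alphabet.{u, v, w, z}} {R : Set (Rule A)} {ap : AppSyms A}
  {Γ Δ : List (Ty A.B)} {s t : Ty A.B}

theorem Step.update {ss : List (Ty A.B)} (f : A.F ss t) {us : Env A (fun _ _ => Empty) ss Γ}
    {r : Ty A.B} (i : Var ss r) {b : PureTm A Γ r} (h : Step R (us r i) b) :
    ∃ vs : Env A (fun _ _ => Empty) ss Γ, Step R (.fn f us) (.fn f vs) ∧ vs r i = b ∧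
      ∀ t₁ (j : Var ss t₁), (⟨t₁, j⟩ : Σ t, Var ss t) ≠ ⟨r, i⟩ → us t₁ j = vs t₁ j := by
  classical
  let vs : Env A (fun _ _ => Empty) ss Γ := fun t j =>
    Function.update (β := fun p : Σ t, Var ss t => PureTm A Γ p.1)
      (fun p => us p.1 p.2) ⟨_, i⟩ b ⟨t, j⟩
  have h1 : vs r i = b := by simp [vs]
  have h2 : ∀ t₁ (j : Var ss t₁), (⟨t₁, j⟩ : Σ t, Var ss t) ≠ ⟨r, i⟩ → us t₁ j = vs t₁ j := by
    intro t₁ j hj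
    simp only [vs]
    rw [Function.update_of_ne hj]
  exact ⟨vs, .arg f i (h1.symm ▸ h) h2, h1, h2⟩

theorem Step.app_left {a a' : PureTm A Γ (.arr s t)} (h : Step R a a') (b : PureTm A Γ s) :
    Step R (Tm.app ap a b) (Tm.app ap a' b) := by
  refine .arg _ .zero h ?_
  rintro r i hi
  cases i with
  | zero => exact (hi rfl).elim
  | succ i => rfl

/-- The instance of the last index of `q` by `b`. -/
abbrev Tm.instZero (q : PureTm A (s :: Γ) t) (b : PureTm A Γ s) : PureTm A Γ t :=
  q.subst (consFam (P := PureTm A Γ) b (fun _ x => .bvar x))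

theorem betaRule_lhs_val (Y : A.Z [s] t) (Y₀ : A.Z [] s) (σ : Valuation A Γ) :
    (betaRule ap Y Y₀).lhs.val σ = Tm.app ap (.abs (σ [s] t Y)) (σ [] s Y₀) := by
  change Tm.fn (ap s t) (fun r i => ((betaRule ap Y Y₀).args r i).val σ) = _
  rw [fn_ap_eq_app]
  congr 1
  · change Tm.abs (Tm.val σ (.mv Y (fun _ i => .bvar i))) = _
    simp only [Tm.val]
    congr 1
    refine Eq.trans ?_ (Tm.subst_id _)
    congr 1
    exact appendFam_inl_inr (P := PureTm A ([s] ++ Γ)) (fun t x => .bvar x)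
  · exact Tm.subst_id _

theorem betaRule_rhs_val (Y : A.Z [s] t) (Y₀ : A.Z [] s) (σ : Valuation A Γ) :
    (betaRule ap Y Y₀).rhs.val σ = (σ [s] t Y).instZero (σ [] s Y₀) := by
  simp only [betaRule, Tm.val]
  congr 1
  simp only [appendFam, consFam_zero, Tm.val]
  congr 1
  exact Tm.subst_id _

theorem IsBetaIDTS.step_beta (hβ : IsBetaIDTS R ap) (q : PureTm A (s :: Γ) t)
    (b : PureTm A Γ s) : Step R (Tm.app ap (.abs q) b) (q.instZero b) := by
  classical
  obtain ⟨Y, Y₀, hY⟩ := hβ.beta_mem s t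
  let V : ∀ W : (Σ (ss : List (Ty A.B)) (s : Ty A.B), A.Z ss s), PureTm A (W.1 ++ Γ) W.2.1 :=
    Function.update (Function.update
      (fun W => .fvar (Classical.choice (A.infinite_X W.2.1).nonempty)) ⟨_, _, Y₀⟩ b) ⟨_, _, Y⟩ q
  let σ : Valuation A Γ := fun ss s W => V ⟨ss, s, W⟩
  have h1 : σ _ _ Y = q := Function.update_self ..
  have h2 : σ _ _ Y₀ = b := by
    -- The arities `[s]` and `[]` differ, so the two updates are at different metavariables and the
    -- outer one does not overwrite the inner.
    refine (Function.update_of_ne ?_ _ _).trans (Function.update_self ..)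
    intro h
    cases congrArg Sigma.fst h
  have := Step.rule _ hY σ
  rwa [betaRule_lhs_val, betaRule_rhs_val, h1, h2] at this

theorem IsBetaIDTS.step_app (hβ : IsBetaIDTS R ap) {a : PureTm A Γ (.arr s t)}
    {b : PureTm A Γ s} {v : PureTm A Γ t} (h : Step R (Tm.app ap a b) v) :
    (∃ a', Step R a a' ∧ v = Tm.app ap a' b) ∨ (∃ b', Step R b b' ∧ v = Tm.app ap a b') ∨
      ∃ q, a = .abs q ∧ v = q.instZero b := by
  rcases step_fn h with ⟨l, r, h1, h2, h3, h4, σ, hR, hus, rfl⟩ | ⟨r, i, vs, hi, he, rfl⟩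
  · obtain ⟨Y, Y₀, hY⟩ := hβ.beta_only _ hR s t rfl
    refine Or.inr (Or.inr ⟨σ _ _ Y, ?_⟩)
    have e1 := betaRule_lhs_val (ap := ap) Y Y₀ σ
    have e2 := betaRule_rhs_val (ap := ap) Y Y₀ σ
    have hl : l = (betaRule ap Y Y₀).args := eq_of_heq (Rule.mk.inj hY).2.2.2.1
    have hr : r = (betaRule ap Y Y₀).rhs := eq_of_heq (Rule.mk.inj hY).2.2.2.2
    have e3 : Tm.app ap a b = Tm.app ap (.abs (σ [s] t Y)) (σ [] s Y₀) := by
      rw [← e1, Tm.app, hus, hl]; rfl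
    obtain ⟨-, ha, hb⟩ := Tm.app_inj e3
    refine ⟨eq_of_heq ha, ?_⟩
    rw [eq_of_heq hb, hr]
    exact e2
  · rw [fn_ap_eq_app]
    cases i with
    | zero =>
      refine Or.inl ⟨_, hi, ?_⟩
      rw [← he _ (.succ .zero) (Var.succ_ne_zero _)]
      rfl
    | succ i => cases i with
      | zero =>
        refine Or.inr (Or.inl ⟨_, hi, ?_⟩)
        rw [← he _ .zero (Var.succ_ne_zero _).symm]
        rfl
      | succ i => exact nomatch i

end Beta

/-! ### Strong normalization and covered subterms -/

section Normalization

variable {A : Alphabet.{u, v, w, z}} {R : Set (Rule A)} {ap : AppSyms A}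
  {Γ Δ : List (Ty A.B)} {s t : Ty A.B}

/-- Strong normalization of a single term. -/
abbrev SN (R : Set (Rule A)) (a : PureTm A Γ t) : Prop := Acc (fun b a => Step R a b) a

theorem SN.of_subst {e : Env A (fun _ _ => Empty) Γ Δ} {a : PureTm A Γ t}
    (h : SN R (a.subst e)) : SN R a :=
  Subrelation.accessible (fun h => Step.subst h e)
    (InvImage.accessible (fun a : PureTm A Γ t => a.subst e) h)

end Normalization

section Subterms

variable {A : Alphabet.{u, v, w, z}} {R : Set (Rule A)} {ap : AppSyms A}
  {Γ Δ : List (Ty A.B)} {s t : Ty A.B}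

theorem funSubterm_fn {M : List (Ty A.B) → Ty A.B → Type m} {a : Tm A M Γ s}
    {ss : List (Ty A.B)} {f : A.F ss t} {us : Env A M ss Γ}
    (h : FunSubterm a (.fn f us)) :
    (⟨s, a⟩ : Σ t, Tm A M Γ t) = ⟨t, .fn f us⟩ ∨ ∃ r, ∃ i : Var ss r, FunSubterm a (us r i) := by
  generalize hb : Tm.fn f us = b at h
  cases h with
  | self => exact Or.inl rfl
  | arg g vs i h => cases hb; exact Or.inr ⟨_, i, h⟩

theorem funSubterm_abs {M : List (Ty A.B) → Ty A.B → Type m} {a : Tm A M Γ s} {r : Ty A.B}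
    {b : Tm A M (r :: Γ) t} (h : FunSubterm a (.abs b)) :
    (⟨s, a⟩ : Σ t, Tm A M Γ t) = ⟨_, .abs b⟩ := by
  generalize hb : Tm.abs b = b' at h
  cases h with
  | self => rfl
  | arg g vs i h => cases hb

theorem funSubterm_bvar {M : List (Ty A.B) → Ty A.B → Type m} {a : Tm A M Γ s} {x : Var Γ t}
    (h : FunSubterm a (.bvar x : Tm A M Γ t)) : (⟨s, a⟩ : Σ t, Tm A M Γ t) = ⟨_, .bvar x⟩ := by
  generalize hb : Tm.bvar x = b' at h
  cases h with
  | self => rfl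
  | arg g vs i h => cases hb

theorem funSubterm_fvar {M : List (Ty A.B) → Ty A.B → Type m} {a : Tm A M Γ s} {x : A.X t}
    (h : FunSubterm a (.fvar x : Tm A M Γ t)) : (⟨s, a⟩ : Σ t, Tm A M Γ t) = ⟨_, .fvar x⟩ := by
  generalize hb : Tm.fvar x = b' at h
  cases h with
  | self => rfl
  | arg g vs i h => cases hb

theorem FunSubterm.rename {a : PureTm A Γ s} {b : PureTm A Γ t} (h : FunSubterm a b)
    (r : Ren Γ Δ) : FunSubterm (a.rename r) (b.rename r) := by
  induction h with
  | self => exact .self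
  | arg f us i h ih => exact .arg f _ i ih

theorem FunSubterm.rename_reflect {r : Ren Γ Δ} {a : PureTm A Δ s} {b : PureTm A Γ t}
    (h : FunSubterm a (b.rename r)) : ∃ c, a = c.rename r ∧ FunSubterm c b := by
  generalize hb : b.rename r = b' at h
  induction h generalizing Γ with
  | self => exact ⟨b, hb.symm, .self⟩
  | arg f us i h ih =>
    cases b with
    | fn g vs =>
      simp only [Tm.rename_fn, Tm.fn.injEq] at hb
      obtain ⟨rfl, hf, hus⟩ := hb
      cases eq_of_heq hf
      cases eq_of_heq hus
      obtain ⟨c, hc, hcb⟩ := ih rfl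
      exact ⟨c, hc, .arg g vs i hcb⟩
    | mv Y _ => exact Y.elim
    | _ => cases hb

theorem FunSubterm.step {a a' : PureTm A Γ s} {b : PureTm A Γ t} (h : FunSubterm a b)
    (ha : Step R a a') : ∃ b', Step R b b' ∧ FunSubterm a' b' := by
  induction h with
  | self => exact ⟨a', ha, .self⟩
  | arg f us i h ih =>
    obtain ⟨b', hb, hab⟩ := ih
    obtain ⟨vs, hs, hi, -⟩ := Step.update f i hb
    exact ⟨_, hs, .arg f vs i (hi ▸ hab)⟩

theorem FunSubterm.inst {Γ' : List (Ty A.B)} {a : MetaTm A Γ s} {b : MetaTm A Γ t}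
    (h : FunSubterm a b) (σ : Valuation A Γ') (e : Env A (fun _ _ => Empty) Γ Δ)
    (d : Env A (fun _ _ => Empty) Γ' Δ) : FunSubterm (a.inst σ e d) (b.inst σ e d) := by
  induction h with
  | self => exact .self
  | arg f us i h ih => exact .arg f _ i ih

theorem FunSubterm.trans {r : Ty A.B} {a : PureTm A Γ s} {b : PureTm A Γ t} {c : PureTm A Γ r}
    (h : FunSubterm a b) (h' : FunSubterm b c) : FunSubterm a c := by
  induction h' with
  | self => exact h
  | arg f us i h ih => exact .arg f _ i ih

/-- `a` is obtained from `b` by replacing, below a prefix of abstractions, an application of a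
function symbol by a proper subterm above which there are only function symbols. -/
inductive ProperCovered : {Γ : List (Ty A.B)} → {s t : Ty A.B} → PureTm A Γ s → PureTm A Γ t →
    Prop
  | fn {Γ ss : List (Ty A.B)} {s r t : Ty A.B} {a : PureTm A Γ s} (f : A.F ss t)
      (us : Env A (fun _ _ => Empty) ss Γ) (i : Var ss r) (h : FunSubterm a (us r i)) :
      ProperCovered a (.fn f us)
  | abs {Γ : List (Ty A.B)} {r s t : Ty A.B} {a : PureTm A (r :: Γ) s} {b : PureTm A (r :: Γ) t}
      (h : ProperCovered a b) : ProperCovered (.abs a) (.abs b)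

theorem ProperCovered.rename {a : PureTm A Γ s} {b : PureTm A Γ t} (h : ProperCovered a b)
    (r : Ren Γ Δ) : ProperCovered (a.rename r) (b.rename r) := by
  induction h generalizing Δ with
  | fn f us i h => exact .fn f _ i (h.rename r)
  | abs h ih => exact .abs (ih _)

theorem ProperCovered.rename_reflect {r : Ren Γ Δ} {a : PureTm A Δ s} {b : PureTm A Γ t}
    (h : ProperCovered a (b.rename r)) : ∃ c, a = c.rename r ∧ ProperCovered c b := by
  generalize hb : b.rename r = b' at h
  induction h generalizing Γ with
  | fn f us i h =>
    cases b with
    | fn g vs =>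
      simp only [Tm.rename_fn, Tm.fn.injEq] at hb
      obtain ⟨rfl, hf, hus⟩ := hb
      cases eq_of_heq hf
      cases eq_of_heq hus
      obtain ⟨c, hc, hcb⟩ := h.rename_reflect
      exact ⟨c, hc, .fn g vs i hcb⟩
    | mv Y _ => exact Y.elim
    | _ => cases hb
  | abs h ih =>
    cases b with
    | abs b =>
      cases hb
      obtain ⟨c, hc, hcb⟩ := ih rfl
      exact ⟨.abs c, hc ▸ rfl, .abs hcb⟩
    | mv Y _ => exact Y.elim
    | _ => cases hb

/-- A step in a covered subterm can be performed in place inside the larger term, since rewriting is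
closed under function symbols and abstractions. The rest of the term is unaffected, so the covering
persists. -/
theorem ProperCovered.step {a a' : PureTm A Γ s} {b : PureTm A Γ t} (h : ProperCovered a b)
    (ha : Step R a a') : ∃ b', Step R b b' ∧ ProperCovered a' b' := by
  induction h with
  | fn f us i h =>
    obtain ⟨b', hb, hab⟩ := h.step ha
    obtain ⟨vs, hs, hi, -⟩ := Step.update f i hb
    exact ⟨_, hs, .fn f vs i (hi ▸ hab)⟩
  | abs h ih =>
    obtain ⟨a₁, ha₁, rfl⟩ := step_abs_iff.1 ha
    obtain ⟨b', hb, hab⟩ := ih ha₁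
    exact ⟨_, .abs hb, .abs hab⟩

/-- Only function symbols and the common abstraction prefix lie on the path between the two
metaterms, and instantiation commutes with both. A nonempty path stays nonempty, so strictness
survives even if instances could have coincided otherwise. -/
theorem covered_inst {Γ' : List (Ty A.B)} {a : MetaTm A Γ s} {b : MetaTm A Γ t}
    (h : Covered a b) (σ : Valuation A Γ') (e : Env A (fun _ _ => Empty) Γ Δ)
    (d : Env A (fun _ _ => Empty) Γ' Δ) :
    (⟨s, a⟩ : Σ t, MetaTm A Γ t) = ⟨t, b⟩ ∨ ProperCovered (a.inst σ e d) (b.inst σ e d) := by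
  induction h generalizing Δ with
  | base h =>
    cases h with
    | self => exact Or.inl rfl
    | arg f us i h => exact Or.inr (.fn f _ i (h.inst σ e d))
  | abs h ih =>
    rcases ih e.lift (fun t x => (d t x).rename (fun _ y => .succ y)) with h | h
    · obtain ⟨rfl, h⟩ := Sigma.mk.inj h
      exact Or.inl (eq_of_heq h ▸ rfl)
    · rw [Tm.inst_abs, Tm.inst_abs]
      exact Or.inr (.abs h)

end Subterms

/-! ### Ordinal rank for reduction combined with covered subterms -/

section Rank

variable {A : Alphabet.{u, v, w, z}} (R : Set (Rule A))
  {Γ Δ : List (Ty A.B)} {s t : Ty A.B}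

/-- `b` reduces to `a`, or `a` is a proper covered subterm of `b`. -/
inductive Descends : (Σ t, PureTm A Γ t) → (Σ t, PureTm A Γ t) → Prop
  | step {t : Ty A.B} {a b : PureTm A Γ t} (h : Step R b a) : Descends ⟨t, a⟩ ⟨t, b⟩
  | covered {s t : Ty A.B} {a : PureTm A Γ s} {b : PureTm A Γ t} (h : ProperCovered a b) :
      Descends ⟨s, a⟩ ⟨t, b⟩

/-- Structural induction, strengthened to all subterms lying below function symbols only: a proper
covered subterm of an application may sit at any such depth. -/
theorem ProperCovered.wf (Γ : List (Ty A.B)) :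
    WellFounded (fun a b : Σ t, PureTm A Γ t => ProperCovered a.2 b.2) := by
  have key : ∀ {Γ : List (Ty A.B)} {t : Ty A.B} (b : PureTm A Γ t) {s : Ty A.B} (a : PureTm A Γ s),
      FunSubterm a b → Acc (fun a b : Σ t, PureTm A Γ t => ProperCovered a.2 b.2) ⟨s, a⟩ := by
    intro Γ t b
    induction b with
    | bvar x =>
      intro s a h
      rw [funSubterm_bvar h]
      refine ⟨_, ?_⟩
      rintro ⟨r, c⟩ hc
      cases hc
    | fvar x =>
      intro s a h
      rw [funSubterm_fvar h]
      refine ⟨_, ?_⟩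
      rintro ⟨r, c⟩ hc
      cases hc
    | @abs Γ q t b ih =>
      intro s a h
      rw [funSubterm_abs h]
      have hb := ih b .self
      -- Every predecessor of an abstraction is the abstraction of a predecessor of its body, so
      -- accessibility transfers from the body.
      have : ∀ B : Σ t, PureTm A (q :: Γ) t,
          Acc (fun a b : Σ t, PureTm A (q :: Γ) t => ProperCovered a.2 b.2) B →
          Acc (fun a b : Σ t, PureTm A Γ t => ProperCovered a.2 b.2) ⟨_, .abs B.2⟩ := by
        intro B hB
        induction hB with
        | intro B _ ih =>
          refine ⟨_, ?_⟩
          rintro ⟨r, c⟩ hc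
          dsimp only at hc
          generalize hd : Tm.abs B.2 = d at hc
          cases hc with
          | fn => cases hd
          | abs hc => cases hd; exact ih ⟨_, _⟩ hc
      exact this _ hb
    | fn f us ih =>
      intro s a h
      rcases funSubterm_fn h with h | ⟨r, i, h⟩
      · rw [h]
        refine ⟨_, ?_⟩
        rintro ⟨r, c⟩ hc
        dsimp only at hc
        generalize hd : Tm.fn f us = d at hc
        cases hc with
        | fn g vs i hc => cases hd; exact ih _ i _ hc
        | abs hc => cases hd
      · exact ih r i a h
    | mv Y us ih => exact Y.elim
  exact ⟨fun a => key a.2 a.2 .self⟩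

variable {R}

/-- Steps commute upwards past covered subterms (`ProperCovered.step`): each step below `b` is
mirrored by a step of `b`. A descent can thus contain no infinite supply of steps, and between steps
the covered-subterm relation is well-founded. The nested induction is on the reduction of `b`, then
on the current covered subterm. -/
theorem SN.acc_descends {b : PureTm A Γ t} (hb : SN R b) : Acc (Descends R) ⟨t, b⟩ := by
  have key : ∀ (a : Σ t, PureTm A Γ t), (a = ⟨t, b⟩ ∨
      Relation.TransGen (fun a b : Σ t, PureTm A Γ t => ProperCovered a.2 b.2) a ⟨t, b⟩) →
      Acc (Descends R) a := by
    induction hb with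
    | intro b _ ihb =>
      intro a
      induction a using (ProperCovered.wf Γ).induction with
      | _ a iha =>
        intro ha
        refine ⟨_, ?_⟩
        rintro c hc
        cases hc with
        | covered hc =>
          refine iha _ hc (Or.inr ?_)
          rcases ha with ha | ha
          · rw [← ha]
            exact .single hc
          · exact .head hc ha
        | @step t' c a hc =>
          have : ∃ b', Step R b b' ∧ ((⟨t', c⟩ : Σ t, PureTm A Γ t) = ⟨t, b'⟩ ∨
              Relation.TransGen (fun a b : Σ t, PureTm A Γ t => ProperCovered a.2 b.2)
                ⟨t', c⟩ ⟨t, b'⟩) := by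
            rcases ha with ha | ha
            · cases ha
              exact ⟨c, hc, Or.inl rfl⟩
            -- The step is lifted through the whole chain of covered subterms, giving a step at its
            -- top `b`; the outer induction hypothesis then applies.
            · have lift : ∀ B : Σ t, PureTm A Γ t,
                  Relation.TransGen (fun a b : Σ t, PureTm A Γ t => ProperCovered a.2 b.2)
                    ⟨t', a⟩ B → ∃ B' : PureTm A Γ B.1, Step R B.2 B' ∧
                  Relation.TransGen (fun a b : Σ t, PureTm A Γ t => ProperCovered a.2 b.2)
                    ⟨t', c⟩ ⟨B.1, B'⟩ := by
                intro B hB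
                induction hB with
                | single h =>
                  obtain ⟨b', h1, h2⟩ := ProperCovered.step h hc
                  exact ⟨b', h1, .single h2⟩
                | tail _ h ih =>
                  obtain ⟨d, h1, h2⟩ := ih
                  obtain ⟨b', h3, h4⟩ := ProperCovered.step h h1
                  exact ⟨b', h3, h2.tail h4⟩
              obtain ⟨b', h1, h2⟩ := lift _ ha
              exact ⟨b', h1, Or.inr h2⟩
          obtain ⟨b', h1, h2⟩ := this
          exact ihb b' h1 _ h2
  exact key _ (Or.inl rfl)

open Classical in
/-- The ordinal rank of a term for `Descends` (and `0` for a term that is not accessible). -/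
noncomputable def descentRank (R : Set (Rule A)) (a : Σ t, PureTm A Γ t) :
    Ordinal.{max u v w} :=
  if h : Acc (Descends R) a then h.rank else 0

theorem descentRank_lt {a b : Σ t, PureTm A Γ t} (h : Descends R a b)
    (hb : Acc (Descends R) b) : descentRank R a < descentRank R b := by
  rw [descentRank, descentRank, dif_pos hb, dif_pos (hb.inv h)]
  exact Acc.rank_lt_of_rel hb h

theorem Descends.rename {a b : Σ t, PureTm A Γ t} (h : Descends R a b) (r : Ren Γ Δ) :
    Descends R ⟨a.1, a.2.rename r⟩ ⟨b.1, b.2.rename r⟩ := by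
  cases h with
  | step h => exact .step (h.rename r)
  | covered h => exact .covered (h.rename r)

theorem Descends.rename_reflect {r : Ren Γ Δ} (hr : r.Inj) {b : Σ t, PureTm A Γ t}
    {a : Σ t, PureTm A Δ t} (h : Descends R a ⟨b.1, b.2.rename r⟩) :
    ∃ c : Σ t, PureTm A Γ t, a = ⟨c.1, c.2.rename r⟩ ∧ Descends R c b := by
  obtain ⟨t, b⟩ := b
  dsimp only at h
  generalize hb : b.rename r = b' at h
  cases h with
  | step h =>
    subst hb
    obtain ⟨c, hc, rfl⟩ := h.rename_reflect hr
    exact ⟨⟨_, c⟩, rfl, .step hc⟩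
  | covered h =>
    subst hb
    obtain ⟨c, rfl, hc⟩ := h.rename_reflect
    exact ⟨⟨_, c⟩, rfl, .covered hc⟩

/-- An injective renaming both preserves and reflects descents, so the two descent trees are
isomorphic. -/
theorem descentRank_rename {r : Ren Γ Δ} (hr : r.Inj) {a : Σ t, PureTm A Γ t}
    (ha : Acc (Descends R) a) :
    descentRank R ⟨a.1, a.2.rename r⟩ = descentRank R a := by
  have hacc : Acc (Descends R) (⟨a.1, a.2.rename r⟩ : Σ t, PureTm A Δ t) := by
    induction ha with
    | intro a _ ih =>
      refine ⟨_, fun c hc => ?_⟩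
      obtain ⟨d, rfl, hd⟩ := Descends.rename_reflect hr hc
      exact ih d hd
  induction ha with
  | intro a h ih =>
    apply le_antisymm
    · rw [descentRank, dif_pos hacc, Acc.rank_eq]
      apply Ordinal.iSup_le
      rintro ⟨c, hc⟩
      obtain ⟨d, rfl, hd⟩ := Descends.rename_reflect hr hc
      have := ih d hd (hacc.inv hc)
      rw [descentRank, dif_pos (hacc.inv hc)] at this
      rw [Order.succ_le_iff]
      dsimp only
      rw [this]
      exact descentRank_lt hd ⟨_, h⟩
    · rw [descentRank, dif_pos ⟨_, h⟩, Acc.rank_eq]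
      apply Ordinal.iSup_le
      rintro ⟨d, hd⟩
      have := ih d hd (hacc.inv (hd.rename r))
      rw [Order.succ_le_iff]
      dsimp only
      have e : descentRank R d = (h d hd).rank := dif_pos (h d hd)
      rw [← e, ← this]
      exact descentRank_lt (hd.rename r) hacc

end Rank

/-! ### Status comparisons -/

section Status

variable {α : Type u} {β : Type v}

theorem mulLt_wf [LinearOrder α] [WellFoundedLT α] :
    WellFounded (MulLt (fun a b : α => a < b)) := by
  refine Subrelation.wf ?_ (Multiset.wellFounded_isDershowitzMannaLT (α := α))
  rintro N P ⟨K, N₁, P₁, rfl, rfl, h, h'⟩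
  exact ⟨K, N₁, P₁, h, rfl, rfl, h'⟩

theorem statLt_wf [LinearOrder α] [WellFoundedLT α] (st : Status) :
    WellFounded (StatLt (fun a b : α => a < b) st) := by
  induction st with
  | nil => exact ⟨fun a => ⟨a, fun _ h => h.elim⟩⟩
  | cons G st ih =>
    -- The whole list is kept as second component, because the remaining groups select from it
    -- again.
    refine Subrelation.wf ?_ (InvImage.wf (fun l : List α => (select G l, l))
      (mulLt_wf.prod_lex ih))
    rintro k l (h | ⟨h, h'⟩)
    · exact Prod.Lex.left _ _ h
    · change Prod.Lex _ _ (select G k, k) (select G l, l)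
      rw [h]
      exact Prod.Lex.right _ h'

theorem StatLt.append {r : α → α → Prop} {st : Status} {k l : List α} (h : StatLt r st k l)
    (st' : Status) : StatLt r (st ++ st') k l := by
  induction st with
  | nil => exact h.elim
  | cons G st ih =>
    rcases h with h | ⟨h, h'⟩
    · exact Or.inl h
    · exact Or.inr ⟨h, ih h'⟩

theorem select_map (G : Set ℕ) (f : α → β) (l : List α) :
    select G (l.map f) = (select G l).map f := by
  simp only [select, List.zipIdx_map, List.filter_map, Multiset.map_coe, List.map_map]
  rfl

theorem mem_of_mem_select {G : Set ℕ} {l : List α} {a : α} (h : a ∈ select G l) : a ∈ l := by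
  simp only [select, Multiset.mem_coe, List.mem_map, List.mem_filter] at h
  obtain ⟨p, ⟨hp, -⟩, rfl⟩ := h
  exact List.fst_mem_of_mem_zipIdx hp

/-- Transfers the schema's comparison of metaterms to ranks. Monotonicity is asked only against
entries of the larger list: those are the left-hand side arguments, whose instances are known to be
accessible. -/
theorem StatLt.map {r : α → α → Prop} {q : β → β → Prop} {f : α → β} {st : Status}
    {k l : List α} (h : StatLt r st k l) (hf : ∀ a, ∀ b ∈ l, r a b → q (f a) (f b)) :
    StatLt q st (k.map f) (l.map f) := by
  induction st with
  | nil => exact h.elim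
  | cons G st ih =>
    rcases h with ⟨K, N, P, hN, hP, h0, hlt⟩ | ⟨h, h'⟩
    · refine Or.inl ⟨K.map f, N.map f, P.map f, ?_, ?_, ?_, ?_⟩
      · rw [select_map, hN, Multiset.map_add]
      · rw [select_map, hP, Multiset.map_add]
      · simpa using h0
      · intro a ha
        obtain ⟨a', ha', rfl⟩ := Multiset.mem_map.1 ha
        obtain ⟨b, hb, hab⟩ := hlt a' ha'
        refine ⟨f b, Multiset.mem_map_of_mem f hb, hf a' b (mem_of_mem_select (G := G) ?_) hab⟩
        rw [hP]
        exact Multiset.mem_add.2 (Or.inr hb)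
    · exact Or.inr ⟨by rw [select_map, select_map, h], ih h'⟩

open Classical in
-- Isolates the dependence of a selected multiset on one entry: the rest `K` is independent of `x`.
theorem exists_select_eq (G : Set ℕ) (p q : List α) :
    ∃ K : Multiset α, ∀ x, select G (p ++ x :: q) = K + if p.length ∈ G then {x} else 0 := by
  refine ⟨(((p.zipIdx.filter (fun y => decide (y.2 ∈ G))).map Prod.fst : List α) : Multiset α) +
    (((q.zipIdx (p.length + 1)).filter (fun y => decide (y.2 ∈ G))).map Prod.fst : List α),
    fun x => ?_⟩
  simp only [select, List.zipIdx_append, List.zipIdx_cons, List.filter_append, List.map_append,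
    Nat.zero_add, ← Multiset.coe_add]
  rw [add_assoc]
  congr 1
  rw [List.filter_cons]
  split_ifs with h1 h2 h2
  · rw [add_comm _ ({x} : Multiset α), Multiset.singleton_add, Multiset.cons_coe, List.map_cons]
  · exact (h2 (by simpa using h1)).elim
  · exact (h1 (by simpa using h2)).elim
  · rw [add_zero]

/-- A status may ignore some positions. The extra last group `Set.univ` makes a decrease at any
single position count, since groups not containing that position tie. -/
theorem statLt_of_lt {r : α → α → Prop} (st : Status) (p q : List α) {x y : α} (h : r x y) :
    StatLt r (st ++ [Set.univ]) (p ++ x :: q) (p ++ y :: q) := by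
  have key : ∀ G : Set ℕ, p.length ∈ G →
      MulLt r (select G (p ++ x :: q)) (select G (p ++ y :: q)) := by
    intro G hG
    obtain ⟨K, hK⟩ := exists_select_eq G p q
    refine ⟨K, {x}, {y}, ?_, ?_, Multiset.singleton_ne_zero y, ?_⟩
    · rw [hK, if_pos hG]
    · rw [hK, if_pos hG]
    · simpa using h
  induction st with
  | nil => exact Or.inl (key _ trivial)
  | cons G st ih =>
    by_cases hG : p.length ∈ G
    · exact Or.inl (key G hG)
    · obtain ⟨K, hK⟩ := exists_select_eq G p q
      exact Or.inr ⟨by rw [hK, hK, if_neg hG, if_neg hG], ih⟩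

theorem argList_split {A : Alphabet.{u, v, w, z}} {M : List (Ty A.B) → Ty A.B → Type m}
    {ss Γ : List (Ty A.B)} {r : Ty A.B} (i : Var ss r) {us vs : Env A M ss Γ}
    (h : ∀ t₁ (j : Var ss t₁), (⟨t₁, j⟩ : Σ t, Var ss t) ≠ ⟨r, i⟩ → us t₁ j = vs t₁ j) :
    ∃ p q, argList us = p ++ ⟨r, us r i⟩ :: q ∧ argList vs = p ++ ⟨r, vs r i⟩ :: q := by
  induction i with
  | @zero Γ' t =>
    have : (fun t' (i : Var Γ' t') => us t' (.succ i)) = fun t' i => vs t' (.succ i) := by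
      funext t' i
      exact h t' (.succ i) (Var.succ_ne_zero _)
    refine ⟨[], _, rfl, ?_⟩
    simp only [argList, this, List.nil_append]
  | @succ Γ' s t i ih =>
    obtain ⟨p, q, h1, h2⟩ := ih (us := fun t' j => us t' (.succ j))
      (vs := fun t' j => vs t' (.succ j)) (fun t₁ j hj => h t₁ (.succ j) fun h' => hj (by
        obtain ⟨rfl, h'⟩ := Sigma.mk.inj h'
        cases eq_of_heq h'
        rfl))
    refine ⟨⟨s, us s .zero⟩ :: p, q, ?_, ?_⟩
    · simp only [argList, h1, List.cons_append]
    · simp only [argList, h2, List.cons_append, h s .zero (Var.succ_ne_zero _).symm]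

theorem mem_argList {A : Alphabet.{u, v, w, z}} {M : List (Ty A.B) → Ty A.B → Type m}
    {ss Γ : List (Ty A.B)} {us : Env A M ss Γ} {a : Σ t, Tm A M Γ t} (h : a ∈ argList us) :
    ∃ r, ∃ i : Var ss r, a = ⟨r, us r i⟩ := by
  induction ss with
  | nil => cases h
  | cons s ss ih =>
    rcases List.mem_cons.1 h with rfl | h
    · exact ⟨s, .zero, rfl⟩
    · obtain ⟨r, i, rfl⟩ := ih h
      exact ⟨r, .succ i, rfl⟩

theorem argList_map {A : Alphabet.{u, v, w, z}} {M : List (Ty A.B) → Ty A.B → Type m}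
    {M' : List (Ty A.B) → Ty A.B → Type*} {ss Γ Δ : List (Ty A.B)} {us : Env A M ss Γ}
    (f : ∀ t, Tm A M Γ t → Tm A M' Δ t) :
    argList (fun t i => f t (us t i)) = (argList us).map (fun a => ⟨a.1, f a.1 a.2⟩) := by
  induction ss with
  | nil => rfl
  | cons s ss ih => simp only [argList, List.map_cons, ih]

end Status

/-! ### Stratified fixpoints -/

section Fixpoint

/-- Well-founded recursion along the strict order supplies the values below a class. Within an
equivalence class the operator is monotone, and Knaster–Tarski gives a greatest fixpoint for all
members simultaneously. -/
theorem exists_fixpoint {B : Type u} {L : B → Type v} [∀ b, CompleteLattice (L b)]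
    (le : B → B → Prop) (le_refl : ∀ b, le b b) (le_trans : ∀ a b c, le a b → le b c → le a c)
    (wf : WellFounded fun a b => le a b ∧ ¬ le b a) (Φ : (∀ b, L b) → ∀ b, L b)
    (hΦ : ∀ b I I', (∀ d, le d b ∧ ¬ le b d → I d = I' d) →
      (∀ d, le d b ∧ le b d → I d ≤ I' d) → Φ I b ≤ Φ I' b) :
    ∃ I, ∀ b, Φ I b = I b := by
  classical
  let ext (b : B) (H : ∀ d, le d b ∧ ¬ le b d → L d) (I : ∀ d, L d) : ∀ d, L d := fun d =>
    if h : le d b ∧ ¬ le b d then H d h else I d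
  -- On the class of `b` this is `Φ` with the strictly smaller values frozen to `H`. The value `⊤`
  -- off the class is irrelevant, as `Φ` on the class does not look there.
  let G (b : B) (H : ∀ d, le d b ∧ ¬ le b d → L d) : (∀ d, L d) →o ∀ d, L d :=
    { toFun := fun I d => if le d b ∧ le b d then Φ (ext b H I) d else ⊤
      monotone' := by
        intro I I' h d
        dsimp only
        split_ifs with hd
        · apply hΦ
          · intro d' hd'
            have : le d' b ∧ ¬ le b d' :=
              ⟨le_trans _ _ _ hd'.1 hd.1, fun h => hd'.2 (le_trans _ _ _ hd.1 h)⟩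
            simp only [ext, dif_pos this]
          · intro d' hd'
            have : ¬ (le d' b ∧ ¬ le b d') := fun h => h.2 (le_trans _ _ _ hd.2 hd'.2)
            simp only [ext, dif_neg this]
            exact h d'
        · exact le_rfl }
  let J : ∀ b, L b := wf.fix fun b H => (G b H).gfp b
  have hJ : ∀ b, J b = (G b fun d _ => J d).gfp b := fun b => wf.fix_eq _ b
  -- The recursion computes a separate greatest fixpoint for each member of a class; equivalent
  -- members have the same operator, so these are components of one fixpoint.
  have hG : ∀ b d, le d b ∧ le b d → (G d fun d _ => J d) = G b fun d _ => J d := by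
    intro b d hd
    apply OrderHom.ext
    funext I c
    have h1 : (le c d ∧ le d c) ↔ (le c b ∧ le b c) :=
      ⟨fun h => ⟨le_trans _ _ _ h.1 hd.1, le_trans _ _ _ hd.2 h.2⟩,
        fun h => ⟨le_trans _ _ _ h.1 hd.2, le_trans _ _ _ hd.1 h.2⟩⟩
    have h2 : ext d (fun d _ => J d) I = ext b (fun d _ => J d) I := by
      funext c
      have h3 : (le c d ∧ ¬ le d c) ↔ (le c b ∧ ¬ le b c) :=
        ⟨fun h => ⟨le_trans _ _ _ h.1 hd.1, fun h' => h.2 (le_trans _ _ _ hd.1 h')⟩,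
          fun h => ⟨le_trans _ _ _ h.1 hd.2, fun h' => h.2 (le_trans _ _ _ hd.2 h')⟩⟩
      simp only [ext, h3]
    change (if le c d ∧ le d c then Φ (ext d _ I) c else ⊤) =
      if le c b ∧ le b c then Φ (ext b _ I) c else ⊤
    rw [h2]
    simp only [h1]
  refine ⟨J, fun b => ?_⟩
  have hgfp : ∀ d, le d b ∧ le b d → J d = (G b fun d _ => J d).gfp d := by
    intro d hd
    rw [hJ d, hG b d hd]
  have e : (G b fun d _ => J d).gfp b = Φ (ext b (fun d _ => J d) (G b fun d _ => J d).gfp) b := by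
    conv_lhs => rw [← OrderHom.map_gfp]
    exact if_pos ⟨le_refl b, le_refl b⟩
  rw [hJ b, e]
  apply le_antisymm <;> apply hΦ
  · intro d hd
    simp only [ext, dif_pos hd]
  · intro d hd
    have : ¬ (le d b ∧ ¬ le b d) := fun h => h.2 hd.2
    simp only [ext, dif_neg this]
    exact (hgfp d hd).le
  · intro d hd
    simp only [ext, dif_pos hd]
  · intro d hd
    have : ¬ (le d b ∧ ¬ le b d) := fun h => h.2 hd.2
    simp only [ext, dif_neg this]
    exact (hgfp d hd).ge

end Fixpoint

/-! ### Labels, worlds and their amalgamation -/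

section Worlds

/-- A condition on the terms in the extensions of the scope `Γ`, stable under injective
renamings. -/
structure Label (A : Alphabet.{u, v, w, z}) (Γ : List (Ty A.B)) where
  holds : ∀ (Γ' : List (Ty A.B)) (_ : Ren Γ Γ') (t : Ty A.B), PureTm A Γ' t → Prop
  inv : ∀ {Γ' Γ'' : List (Ty A.B)} (r : Ren Γ Γ') (k : Ren Γ' Γ''), k.Inj →
    ∀ {t : Ty A.B} (a : PureTm A Γ' t),
      holds Γ'' (fun s x => k s (r s x)) t (a.rename k) ↔ holds Γ' r t a

/-- A world assigns to each index a condition on the terms to which it may be applied. -/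
abbrev World (A : Alphabet.{u, v, w, z}) (Γ : List (Ty A.B)) := ∀ t, Var Γ t → Label A Γ

variable {A : Alphabet.{u, v, w, z}} {Γ Γ' Γ'' Δ : List (Ty A.B)} {s t : Ty A.B}

/-- Transport of a label to an extended scope. -/
def Label.tr (L : Label A Γ) (r : Ren Γ Γ') : Label A Γ' where
  holds Δ k t a := L.holds Δ (fun s x => k s (r s x)) t a
  inv q k hk _ a := L.inv (fun s x => q s (r s x)) k hk a

instance : Inhabited (Label A Γ) := ⟨⟨fun _ _ _ _ => True, fun _ _ _ _ _ => Iff.rfl⟩⟩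

/-- The renaming `r` embeds the world `w` into the world `w'`. -/
structure Emb (w : World A Γ) (w' : World A Γ') (r : Ren Γ Γ') : Prop where
  inj : r.Inj
  compat : ∀ t x, w' t (r t x) = (w t x).tr r

theorem Emb.refl (w : World A Γ) : Emb w w (fun _ x => x) := ⟨fun _ _ _ h => h, fun _ _ => rfl⟩

theorem Emb.trans {w : World A Γ} {w' : World A Γ'} {w'' : World A Γ''} {r : Ren Γ Γ'}
    {q : Ren Γ' Γ''} (h : Emb w w' r) (h' : Emb w' w'' q) : Emb w w'' (fun t x => q t (r t x)) :=
  ⟨fun t _ _ hx => h.inj t (h'.inj t hx), fun t x => by rw [h'.compat, h.compat]; rfl⟩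

open Classical in
-- A pushout of scopes: indices of `Γ'` coming from `Γ` are identified with their copies in `Γ₁`,
-- the others go to the fresh part of `Γ₁ ++ Γ'`. The last clause says that nothing else is
-- identified.
theorem exists_amalgam {Γ₁ : List (Ty A.B)} {r : Ren Γ Γ'} {r₁ : Ren Γ Γ₁} (hr : r.Inj)
    (hr₁ : r₁.Inj) : ∃ (Γ₂ : List (Ty A.B)) (j : Ren Γ' Γ₂) (j₁ : Ren Γ₁ Γ₂), j.Inj ∧ j₁.Inj ∧
      (∀ t x, j t (r t x) = j₁ t (r₁ t x)) ∧
      ∀ t y y₁, j t y = j₁ t y₁ → ∃ x, y = r t x ∧ y₁ = r₁ t x := by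
  let j : Ren Γ' (Γ₁ ++ Γ') := fun t y =>
    if h : ∃ x, r t x = y then (r₁ t h.choose).inl Γ' else y.inr Γ₁
  have hj : ∀ t x, j t (r t x) = (r₁ t x).inl Γ' := by
    intro t x
    have h : ∃ x', r t x' = r t x := ⟨x, rfl⟩
    simp only [j, dif_pos h]
    rw [hr t h.choose_spec]
  have hj' : ∀ t y, (¬ ∃ x, r t x = y) → j t y = y.inr Γ₁ := fun t y h => by
    simp only [j, dif_neg h]
  refine ⟨Γ₁ ++ Γ', j, fun _ y => y.inl Γ', ?_, fun t => Var.inl_injective Γ', hj, ?_⟩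
  · intro t y y' h
    by_cases hy : ∃ x, r t x = y <;> by_cases hy' : ∃ x, r t x = y'
    · obtain ⟨x, rfl⟩ := hy
      obtain ⟨x', rfl⟩ := hy'
      rw [hj, hj] at h
      rw [hr₁ t (Var.inl_injective Γ' h)]
    · obtain ⟨x, rfl⟩ := hy
      rw [hj, hj' t y' hy'] at h
      exact (Var.inl_ne_inr _ _ h).elim
    · obtain ⟨x', rfl⟩ := hy'
      rw [hj, hj' t y hy] at h
      exact (Var.inl_ne_inr _ _ h.symm).elim
    · rw [hj' t y hy, hj' t y' hy'] at h
      exact Var.inr_injective Γ₁ h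
  · intro t y y₁ h
    by_cases hy : ∃ x, r t x = y
    · obtain ⟨x, rfl⟩ := hy
      rw [hj] at h
      exact ⟨x, rfl, (Var.inl_injective Γ' h).symm⟩
    · rw [hj' t y hy] at h
      exact (Var.inl_ne_inr _ _ h.symm).elim

open Classical in
-- On the overlap both worlds carry labels transported from `w`, so the labels can be glued; indices
-- outside both images get the trivial label.
theorem Emb.amalgam {Γ₁ : List (Ty A.B)} {w : World A Γ} {w' : World A Γ'} {w₁ : World A Γ₁}
    {r : Ren Γ Γ'} {r₁ : Ren Γ Γ₁} (h : Emb w w' r) (h₁ : Emb w w₁ r₁) :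
    ∃ (Γ₂ : List (Ty A.B)) (w₂ : World A Γ₂) (j : Ren Γ' Γ₂) (j₁ : Ren Γ₁ Γ₂),
      Emb w' w₂ j ∧ Emb w₁ w₂ j₁ ∧ ∀ t x, j t (r t x) = j₁ t (r₁ t x) := by
  obtain ⟨Γ₂, j, j₁, hj, hj₁, e, he⟩ := exists_amalgam h.inj h₁.inj
  let w₂ : World A Γ₂ := fun t y =>
    if h : ∃ x, j₁ t x = y then (w₁ t h.choose).tr j₁
    else if h : ∃ x, j t x = y then (w' t h.choose).tr j else default
  have h2 : ∀ t x, w₂ t (j₁ t x) = (w₁ t x).tr j₁ := by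
    intro t x
    have hx : ∃ x', j₁ t x' = j₁ t x := ⟨x, rfl⟩
    simp only [w₂, dif_pos hx]
    rw [hj₁ t hx.choose_spec]
  refine ⟨Γ₂, w₂, j, j₁, ⟨hj, fun t y => ?_⟩, ⟨hj₁, h2⟩, e⟩
  by_cases hy : ∃ y₁, j₁ t y₁ = j t y
  · obtain ⟨y₁, hy₁⟩ := hy
    obtain ⟨x, rfl, rfl⟩ := he t y y₁ hy₁.symm
    rw [e, h2, h.compat, h₁.compat]
    have : (fun s x => j s (r s x)) = fun s x => j₁ s (r₁ s x) := by funext s x; exact e s x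
    change (w t x).tr (fun s x => j₁ s (r₁ s x)) = (w t x).tr (fun s x => j s (r s x))
    rw [this]
  · have hx : ∃ x', j t x' = j t y := ⟨y, rfl⟩
    simp only [w₂, dif_neg hy, dif_pos hx]
    rw [hj t hx.choose_spec]

open Classical in
theorem exists_push (w : World A Γ) {r : Ren Γ Γ'} (hr : r.Inj) : ∃ w', Emb w w' r := by
  refine ⟨fun t y => if h : ∃ x, r t x = y then (w t h.choose).tr r else default, hr, ?_⟩
  intro t x
  have hx : ∃ x', r t x' = r t x := ⟨x, rfl⟩
  simp only [dif_pos hx]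
  rw [hr t hx.choose_spec]

end Worlds

/-! ### Good terms -/

section Good

variable {A : Alphabet.{u, v, w, z}} {R : Set (Rule A)} {ap : AppSyms A}
  {Γ Γ' Δ : List (Ty A.B)} {s t : Ty A.B}

theorem SN.rename {r : Ren Γ Δ} (hr : r.Inj) {a : PureTm A Γ t} :
    SN R (a.rename r) ↔ SN R a := by
  constructor
  · intro h
    rw [Tm.rename_eq_subst] at h
    exact SN.of_subst h
  · intro h
    induction h with
    | intro a _ ih =>
      refine ⟨_, fun v hv => ?_⟩
      obtain ⟨b, hb, rfl⟩ := Step.rename_reflect hr hv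
      exact ih b hb

/-- Reduction in any number of steps. -/
abbrev Steps (R : Set (Rule A)) : PureTm A Γ t → PureTm A Γ t → Prop :=
  Relation.ReflTransGen (Step R)

theorem Steps.rename {a b : PureTm A Γ t} (h : Steps R a b) (r : Ren Γ Δ) :
    Steps R (a.rename r) (b.rename r) := by
  induction h with
  | refl => exact .refl
  | tail _ h ih => exact ih.tail (h.rename r)

theorem Steps.rename_reflect {r : Ren Γ Δ} (hr : r.Inj) {a : PureTm A Γ t} {v : PureTm A Δ t}
    (h : Steps R (a.rename r) v) : ∃ b, Steps R a b ∧ v = b.rename r := by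
  induction h with
  | refl => exact ⟨a, .refl, rfl⟩
  | tail _ h ih =>
    obtain ⟨b, hb, rfl⟩ := ih
    obtain ⟨c, hc, rfl⟩ := Step.rename_reflect hr h
    exact ⟨c, hb.tail hc, rfl⟩

/-- The term is the index `x` applied to some arguments. -/
inductive HeadedBy (ap : AppSyms A) {Γ : List (Ty A.B)} {s : Ty A.B} (x : Var Γ s) :
    {t : Ty A.B} → PureTm A Γ t → Prop
  | bvar : HeadedBy ap x (.bvar x)
  | app {t t' : Ty A.B} {a : PureTm A Γ (.arr t t')} (h : HeadedBy ap x a) (b : PureTm A Γ t) :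
      HeadedBy ap x (Tm.app ap a b)

theorem headedBy_app {x : Var Γ s} {t' : Ty A.B} {a : PureTm A Γ (.arr t t')} {b : PureTm A Γ t}
    (h : HeadedBy ap x (Tm.app ap a b)) : HeadedBy ap x a := by
  generalize hc : Tm.app ap a b = c at h
  cases h with
  | bvar => cases hc
  | app h b =>
    obtain ⟨rfl, h1, -⟩ := Tm.app_inj hc
    cases eq_of_heq h1
    exact h

theorem HeadedBy.rename {x : Var Γ s} {a : PureTm A Γ t} (h : HeadedBy ap x a) (r : Ren Γ Δ) :
    HeadedBy ap (r s x) (a.rename r) := by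
  induction h with
  | bvar => exact .bvar
  | app h b ih => rw [Tm.rename_app]; exact .app ih _

theorem app_eq_rename {t' : Ty A.B} {a : PureTm A Δ (.arr t t')} {b : PureTm A Δ t}
    {r : Ren Γ Δ} {c : PureTm A Γ t'} (h : Tm.app ap a b = c.rename r) :
    ∃ a' b', c = Tm.app ap a' b' ∧ a = a'.rename r ∧ b = b'.rename r := by
  cases c with
  | fn f us =>
    simp only [Tm.app, Tm.rename_fn, Tm.fn.injEq] at h
    obtain ⟨rfl, hf, hus⟩ := h
    cases eq_of_heq hf
    have hus := eq_of_heq hus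
    refine ⟨_, _, fn_ap_eq_app us, ?_, ?_⟩
    · exact congrFun (congrFun hus _) .zero
    · exact congrFun (congrFun hus _) (.succ .zero)
  | mv Y _ => exact Y.elim
  | _ => cases h

theorem HeadedBy.rename_reflect {r : Ren Γ Δ} {y : Var Δ s} {a : PureTm A Γ t}
    (h : HeadedBy ap y (a.rename r)) : ∃ x, y = r s x ∧ HeadedBy ap x a := by
  generalize ha : a.rename r = a' at h
  induction h with
  | bvar =>
    cases a with
    | bvar x => cases ha; exact ⟨x, rfl, .bvar⟩
    | mv Y _ => exact Y.elim
    | _ => cases ha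
  | app h b ih =>
    obtain ⟨c, d, rfl, h1, h2⟩ := app_eq_rename ha.symm
    obtain ⟨x, hx, hc⟩ := ih h1.symm
    exact ⟨x, hx, .app hc d⟩

theorem HeadedBy.not_abs {x : Var Γ s} {r : Ty A.B} {b : PureTm A (r :: Γ) t} :
    ¬ HeadedBy ap x (Tm.abs b) := by
  intro h
  generalize hc : Tm.abs b = c at h
  cases h with
  | bvar => cases hc
  | app h b => cases hc

/-- The head is an index, never an abstraction, so no β-redex arises along the spine and steps take
place inside the arguments. -/
theorem HeadedBy.step (hβ : IsBetaIDTS R ap) {x : Var Γ s} {a a' : PureTm A Γ t}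
    (h : HeadedBy ap x a) (ha : Step R a a') : HeadedBy ap x a' := by
  induction h with
  | bvar => exact (not_step_bvar ha).elim
  | app h b ih =>
    rcases hβ.step_app ha with ⟨c, hc, rfl⟩ | ⟨c, hc, rfl⟩ | ⟨q, rfl, rfl⟩
    · exact .app (ih hc) b
    · exact .app h c
    · exact h.not_abs.elim

/-- The arguments to which the indices are applied, at positions above which there are only
function symbols, satisfy the conditions imposed by the world `w`. -/
def LocalGood (ap : AppSyms A) (w : World A Γ) (a : PureTm A Γ t) : Prop :=
  ∀ ⦃s : Ty A.B⦄ (x : Var Γ s) ⦃s' t' : Ty A.B⦄ (b : PureTm A Γ (.arr s' t')) (c : PureTm A Γ s'),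
    HeadedBy ap x b → FunSubterm (Tm.app ap b c) a → (w s x).holds Γ (fun _ x => x) s' c

/-- The term is strongly normalizing and its reducts are locally good. -/
def Good (R : Set (Rule A)) (ap : AppSyms A) (w : World A Γ) (a : PureTm A Γ t) : Prop :=
  SN R a ∧ ∀ a', Steps R a a' → LocalGood ap w a'

theorem localGood_rename {w : World A Γ} {w' : World A Γ'} {r : Ren Γ Γ'} (h : Emb w w' r)
    {a : PureTm A Γ t} : LocalGood ap w' (a.rename r) ↔ LocalGood ap w a := by
  have key : ∀ {s : Ty A.B} (x : Var Γ s) {s' : Ty A.B} (c : PureTm A Γ s'),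
      (w' s (r s x)).holds Γ' (fun _ x => x) s' (c.rename r) ↔
        (w s x).holds Γ (fun _ x => x) s' c := by
    intro s x s' c
    rw [h.compat]
    exact (w s x).inv (fun _ x => x) r h.inj c
  constructor
  · intro ha s x s' t' b c hb hbc
    refine (key x c).1 (ha (r s x) (b.rename r) (c.rename r) (hb.rename r) ?_)
    rw [← Tm.rename_app]
    exact hbc.rename r
  · intro ha s y s' t' b c hb hbc
    obtain ⟨d, hd, hda⟩ := hbc.rename_reflect
    obtain ⟨b', c', rfl, rfl, rfl⟩ := app_eq_rename hd
    obtain ⟨x, rfl, hx⟩ := hb.rename_reflect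
    exact (key x c').2 (ha x b' c' hx hda)

theorem good_rename {w : World A Γ} {w' : World A Γ'} {r : Ren Γ Γ'} (h : Emb w w' r)
    {a : PureTm A Γ t} : Good R ap w' (a.rename r) ↔ Good R ap w a := by
  refine and_congr (SN.rename h.inj) ⟨fun ha a' ha' => ?_, fun ha a' ha' => ?_⟩
  · exact (localGood_rename h).1 (ha _ (ha'.rename r))
  · obtain ⟨b, hb, rfl⟩ := Steps.rename_reflect h.inj ha'
    exact (localGood_rename h).2 (ha b hb)

theorem Good.step {w : World A Γ} {a a' : PureTm A Γ t} (h : Good R ap w a) (ha : Step R a a') :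
    Good R ap w a' :=
  ⟨h.1.inv ha, fun b hb => h.2 b (.head ha hb)⟩

theorem Good.steps {w : World A Γ} {a a' : PureTm A Γ t} (h : Good R ap w a)
    (ha : Steps R a a') : Good R ap w a' := by
  induction ha with
  | refl => exact h
  | tail _ hs ih => exact ih.step hs

/-- Reductions of a subterm lift to the whole term, keeping it a subterm below function symbols, and
local goodness inspects all such positions. -/
theorem Good.funSubterm {w : World A Γ} {a : PureTm A Γ t} {b : PureTm A Γ s}
    (h : Good R ap w a) (hb : FunSubterm b a) : Good R ap w b := by
  obtain ⟨hsn, hl⟩ := h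
  constructor
  · induction hsn generalizing b with
    | intro a _ ih =>
      refine ⟨_, fun c hc => ?_⟩
      obtain ⟨a', ha', hca⟩ := hb.step hc
      exact ih a' ha' hca fun a'' ha'' => hl a'' (.head ha' ha'')
  · intro c hc
    have : ∃ a', Steps R a a' ∧ FunSubterm c a' := by
      induction hc with
      | refl => exact ⟨a, .refl, hb⟩
      | tail _ h ih =>
        obtain ⟨a', ha', hca⟩ := ih
        obtain ⟨a'', ha'', hca'⟩ := hca.step h
        exact ⟨a'', ha'.tail ha'', hca'⟩
    obtain ⟨a', ha', hca⟩ := this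
    exact fun s x s' t' d e hd hde => hl a' ha' x d e hd (hde.trans hca)

theorem good_of_steps {w : World A Γ} {a : PureTm A Γ t} (h : LocalGood ap w a)
    (hs : ∀ b, Step R a b → Good R ap w b) : Good R ap w a := by
  refine ⟨⟨_, fun b hb => (hs b hb).1⟩, fun b hb => ?_⟩
  rcases Relation.ReflTransGen.cases_head hb with rfl | ⟨c, hc, hcb⟩
  · exact h
  · exact (hs c hc).2 b hcb

theorem localGood_fn {w : World A Γ} {ss : List (Ty A.B)} {f : A.F ss t}
    {us : Env A (fun _ _ => Empty) ss Γ} (hus : ∀ r i, LocalGood ap w (us r i))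
    (hf : ∀ {s' : Ty A.B} {b : PureTm A Γ (.arr s' t)} {c : PureTm A Γ s'},
      Tm.fn f us = Tm.app ap b c → ∀ {s : Ty A.B} (x : Var Γ s), HeadedBy ap x b →
        (w s x).holds Γ (fun _ x => x) s' c) : LocalGood ap w (Tm.fn f us) := by
  intro s x s' t' b c hb hbc
  rcases funSubterm_fn hbc with h | ⟨r, i, h⟩
  · obtain ⟨rfl, h⟩ := Sigma.mk.inj h
    exact hf (eq_of_heq h).symm x hb
  · exact hus r i x b c hb h

theorem localGood_app {w : World A Γ} {a : PureTm A Γ (.arr s t)} {b : PureTm A Γ s}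
    (ha : LocalGood ap w a) (hb : LocalGood ap w b)
    (h : ∀ {s' : Ty A.B} (x : Var Γ s'), HeadedBy ap x a →
      (w s' x).holds Γ (fun _ x => x) s b) : LocalGood ap w (Tm.app ap a b) := by
  refine localGood_fn (fun r i => ?_) fun {s' c d} he s'' x hx => ?_
  · cases i with
    | zero => exact ha
    | succ i => cases i with
      | zero => exact hb
      | succ i => exact nomatch i
  · obtain ⟨rfl, h1, h2⟩ := Tm.app_inj he
    cases eq_of_heq h1
    cases eq_of_heq h2
    exact h x hx

end Good

/-! ### Computability predicates -/

section Computability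

variable {A : Alphabet.{u, v, w, z}} {R : Set (Rule A)} {ap : AppSyms A} {C : Constructors A}
  {stat : Sym A → Status} {Γ Γ' Δ : List (Ty A.B)} {s t : Ty A.B}

/-- Interpretations of the base types in all worlds. -/
abbrev Interp (A : Alphabet.{u, v, w, z}) :=
  ∀ (b : A.B) (Γ : List (Ty A.B)), World A Γ → PureTm A Γ (.base b) → Prop

/-- The computable terms of a type, in a world. -/
def Comp (ap : AppSyms A) (I : Interp A) :
    (t : Ty A.B) → {Γ : List (Ty A.B)} → World A Γ → PureTm A Γ t → Prop
  | .base b, Γ, w, a => I b Γ w a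
  | .arr s t, Γ, _w, a => ∀ (Γ' : List (Ty A.B)) (w' : World A Γ') (r : Ren Γ Γ'), Emb _w w' r →
      ∀ c : PureTm A Γ' s, Comp ap I s w' c → Comp ap I t w' (Tm.app ap (a.rename r) c)

/-- Stability of a predicate under the embeddings of worlds. -/
def Stable {t : Ty A.B} (P : ∀ Γ : List (Ty A.B), World A Γ → PureTm A Γ t → Prop) : Prop :=
  ∀ ⦃Γ Γ' : List (Ty A.B)⦄ ⦃w : World A Γ⦄ ⦃w' : World A Γ'⦄ ⦃r : Ren Γ Γ'⦄, Emb w w' r →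
    ∀ a : PureTm A Γ t, P Γ' w' (a.rename r) ↔ P Γ w a

/-- At arrow types, preservation composes embeddings. Reflection is the harder half: an argument
given in another extension of `w` is moved to an amalgam with `w'`, where the hypothesis applies,
and the result is reflected back. -/
theorem stable_comp {I : Interp A} (hI : ∀ b, Stable (I b)) (t : Ty A.B) :
    Stable (fun _ w a => Comp ap I t w a) := by
  induction t with
  | base b => exact hI b
  | arr s t ihs iht =>
    intro Γ Γ' w w' r h a
    constructor
    · intro ha Γ₁ w₁ r₁ h₁ c hc
      obtain ⟨Γ₂, w₂, j, j₁, hj, hj₁, e⟩ := h.amalgam h₁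
      have := ha Γ₂ w₂ j hj (c.rename j₁) ((ihs hj₁ c).2 hc)
      rw [Tm.rename_rename] at this
      simp only [e] at this
      rw [← Tm.rename_rename, ← Tm.rename_app] at this
      exact (iht hj₁ _).1 this
    · intro ha Γ₁ w₁ r₁ h₁ c hc
      rw [Tm.rename_rename]
      exact ha Γ₁ w₁ _ (h.trans h₁) c hc

theorem comp_mono {I I' : Interp A} (t : Ty A.B)
    (h : ∀ d, t.OccursAt true d → ∀ (Γ : List (Ty A.B)) (w : World A Γ) a, I d Γ w a → I' d Γ w a)
    (h' : ∀ d, t.OccursAt false d →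
      ∀ (Γ : List (Ty A.B)) (w : World A Γ) a, I' d Γ w a → I d Γ w a)
    (w : World A Γ) (a : PureTm A Γ t) (ha : Comp ap I t w a) : Comp ap I' t w a := by
  induction t generalizing I I' Γ with
  | base b => exact h b ⟨rfl, rfl⟩ Γ w a ha
  | arr s t ihs iht =>
    intro Γ₁ w₁ r₁ h₁ c hc
    refine iht (fun d hd => h d (Or.inr hd)) (fun d hd => h' d (Or.inr hd)) _ _
      (ha Γ₁ w₁ r₁ h₁ c ?_)
    exact ihs (fun d hd => h' d (Or.inl hd)) (fun d hd => h d (Or.inl hd)) _ _ hc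

/-- An interpretation of the base types that is compatible with the constructors. -/
structure IsInterp (R : Set (Rule A)) (ap : AppSyms A) (C : Constructors A) (I : Interp A) :
    Prop where
  stable : ∀ b, Stable (I b)
  iff : ∀ (b : A.B) (Γ : List (Ty A.B)) (w : World A Γ) (a : PureTm A Γ (.base b)),
    I b Γ w a ↔ Good R ap w a ∧ ∀ (ss : List (Ty A.B)) (c : A.F ss (.base b)), c ∈ C b ss →
      ∀ us : Env A (fun _ _ => Empty) ss Γ, Steps R a (.fn c us) →
        ∀ r (i : Var ss r), Comp ap I r w (us r i)

theorem fn_eq_rename {ss : List (Ty A.B)} {f : A.F ss t} {us : Env A (fun _ _ => Empty) ss Δ}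
    {r : Ren Γ Δ} {c : PureTm A Γ t} (h : Tm.fn f us = c.rename r) :
    ∃ vs, c = .fn f vs ∧ us = fun t i => (vs t i).rename r := by
  cases c with
  | fn g vs =>
    simp only [Tm.rename_fn, Tm.fn.injEq] at h
    obtain ⟨rfl, hf, hus⟩ := h
    cases eq_of_heq hf
    exact ⟨vs, rfl, eq_of_heq hus⟩
  | mv Y _ => exact Y.elim
  | _ => cases h

/-- The stable predicates on the terms of a base type. -/
def stablePredicates (A : Alphabet.{u, v, w, z}) (b : A.B) : CompleteSublattice
    (∀ Γ : List (Ty A.B), World A Γ → PureTm A Γ (.base b) → Prop) :=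
  CompleteSublattice.mk' {P | Stable P}
    (by
      intro S hS Γ Γ' w w' r h a
      simp only [sSup_apply, iSup_apply, iSup_Prop_eq]
      exact exists_congr fun P => hS P.2 h a)
    (by
      intro S hS Γ Γ' w w' r h a
      simp only [sInf_apply, iInf_apply, iInf_Prop_eq]
      exact forall_congr' fun P => hS P.2 h a)

/-- The fixpoint is taken in the complete lattice of stable predicates, so that stability comes with
it. An occurrence in an argument type of a constructor of `b` is either strictly below `b`, where
the interpretations agree, or equivalent to `b` and then positive. -/
theorem exists_isInterp (hA : Assumptions R C stat) : ∃ I, IsInterp R ap C I := by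
  let Ψ : Interp A → Interp A := fun I b Γ w a =>
    Good R ap w a ∧ ∀ (ss : List (Ty A.B)) (c : A.F ss (.base b)), c ∈ C b ss →
      ∀ us : Env A (fun _ _ => Empty) ss Γ, Steps R a (.fn c us) →
        ∀ r (i : Var ss r), Comp ap I r w (us r i)
  have hΨ : ∀ I, (∀ b, Stable (I b)) → ∀ b, Stable (Ψ I b) := by
    intro I hI b Γ Γ' w w' r h a
    refine and_congr (good_rename h) (forall_congr' fun ss => forall_congr' fun c =>
      imp_congr_right fun _ => ⟨fun H us hus t i => ?_, fun H us hus t i => ?_⟩)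
    · exact (stable_comp hI t h _).1 (H _ (hus.rename r) t i)
    · obtain ⟨d, hd, e⟩ := Steps.rename_reflect h.inj hus
      obtain ⟨vs, rfl, rfl⟩ := fn_eq_rename e
      exact (stable_comp hI t h _).2 (H _ hd t i)
  let Φ : (∀ b, stablePredicates A b) → ∀ b, stablePredicates A b := fun I b =>
    ⟨Ψ (fun b => (I b).1) b, hΨ _ (fun b => (I b).2) b⟩
  have occ : ∀ {b : A.B} {ss : List (Ty A.B)} {c : A.F ss (.base b)}, c ∈ C b ss →
      ∀ {r : Ty A.B}, r ∈ ss → ∀ {pol : Bool} {d : A.B}, r.OccursAt pol d → BLe C d b :=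
    fun hc _ hr pol _ hd => Relation.ReflTransGen.single ⟨_, _, hc, _, hr, pol, hd⟩
  obtain ⟨I, hI⟩ := exists_fixpoint (L := fun b => stablePredicates A b) (BLe C)
    (fun _ => .refl) (fun _ _ _ h h' => Relation.ReflTransGen.trans h' h) hA.wf_base Φ (by
      intro b I I' hlt heq Γ w a
      rintro ⟨h1, h2⟩
      refine ⟨h1, fun ss c hc us hus r i => ?_⟩
      have hr : r ∈ ss := i.mem
      refine comp_mono r ?_ ?_ w _ (h2 ss c hc us hus r i)
      · intro d hd Γ w a ha
        by_cases hbd : BLe C b d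
        · exact heq d ⟨occ hc hr hd, hbd⟩ Γ w a ha
        · rwa [← hlt d ⟨occ hc hr hd, hbd⟩]
      · intro d hd Γ w a ha
        by_cases hbd : BLe C b d
        · exact (hA.positive b ss c hc r hr d ⟨occ hc hr hd, hbd⟩ hd).elim
        · rwa [hlt d ⟨occ hc hr hd, hbd⟩])
  exact ⟨fun b => (I b).1, fun b => (I b).2, fun b Γ w a => by
    conv_lhs => rw [← hI b]⟩

/-- The terms that interact with their context: abstractions, constructors and indices applied
to arguments. -/
inductive Active (ap : AppSyms A) (C : Constructors A) {Γ : List (Ty A.B)} :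
    {t : Ty A.B} → PureTm A Γ t → Prop
  | abs {s t : Ty A.B} (b : PureTm A (s :: Γ) t) : Active ap C (.abs b)
  | ctor {ss : List (Ty A.B)} {b : A.B} {c : A.F ss (.base b)} (hc : c ∈ C b ss)
      (us : Env A (fun _ _ => Empty) ss Γ) : Active ap C (.fn c us)
  | headed {s t : Ty A.B} {x : Var Γ s} {a : PureTm A Γ t} (h : HeadedBy ap x a) : Active ap C a

theorem active_fn {ss : List (Ty A.B)} {f : A.F ss t} {us : Env A (fun _ _ => Empty) ss Γ}
    (h : Active ap C (.fn f us)) :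
    (∃ b, ∃ c : A.F ss (.base b), c ∈ C b ss ∧ (⟨ss, t, f⟩ : Sym A) = ⟨ss, .base b, c⟩) ∨
    ∃ s, ∃ x : Var Γ s, HeadedBy ap x (.fn f us) := by
  generalize ha : Tm.fn f us = a at h
  cases h with
  | abs b => cases ha
  | ctor hc vs => cases ha; exact Or.inl ⟨_, _, hc, rfl⟩
  | headed h => exact Or.inr ⟨_, _, h⟩

theorem ap_not_ctor (hβ : IsBetaIDTS R ap) (hA : Assumptions R C stat) {b : A.B}
    {ss : List (Ty A.B)} {c : A.F ss (.base b)} (hc : c ∈ C b ss) :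
    (⟨_, _, ap s t⟩ : Sym A) ≠ ⟨ss, .base b, c⟩ := by
  obtain ⟨Y, Y₀, h⟩ := hβ.beta_mem s t
  exact hA.head_not_ctor _ h b ss c hc

theorem active_app (hβ : IsBetaIDTS R ap) (hA : Assumptions R C stat) {a : PureTm A Γ (.arr s t)}
    {b : PureTm A Γ s} (h : Active ap C (Tm.app ap a b)) : Active ap C a := by
  rcases active_fn h with ⟨d, c, hc, e⟩ | ⟨r, x, hx⟩
  · exact (ap_not_ctor hβ hA hc e).elim
  · exact .headed (headedBy_app hx)

theorem Active.rename_reflect {r : Ren Γ Δ} {a : PureTm A Γ t} (h : Active ap C (a.rename r)) :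
    Active ap C a := by
  generalize hb : a.rename r = b at h
  cases h with
  | abs b =>
    cases a with
    | abs a => exact .abs a
    | mv Y _ => exact Y.elim
    | _ => cases hb
  | ctor hc us =>
    obtain ⟨vs, rfl, -⟩ := fn_eq_rename hb.symm
    exact .ctor hc vs
  | headed h =>
    subst hb
    obtain ⟨x, -, hx⟩ := h.rename_reflect
    exact .headed hx

variable {I : Interp A}

theorem comp_step (hI : IsInterp R ap C I) {w : World A Γ} {a a' : PureTm A Γ t}
    (h : Comp ap I t w a) (ha : Step R a a') : Comp ap I t w a' := by
  induction t generalizing Γ with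
  | base b =>
    rw [Comp, hI.iff] at h ⊢
    exact ⟨h.1.step ha, fun ss c hc us hus => h.2 ss c hc us (.head ha hus)⟩
  | arr s t ihs iht =>
    intro Γ' w' r hr c hc
    exact iht (h Γ' w' r hr c hc) ((ha.rename r).app_left c)

theorem localGood_fvar {w : World A Γ} {x : A.X t} : LocalGood ap w (.fvar x : PureTm A Γ t) := by
  intro s x s' t' b c hb hbc
  obtain ⟨rfl, h⟩ := Sigma.mk.inj (funSubterm_fvar hbc)
  cases eq_of_heq h

theorem not_active_fvar {x : A.X t} : ¬ Active ap C (.fvar x : PureTm A Γ t) := by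
  intro hx
  generalize ha : Tm.fvar _ = a at hx
  cases hx with
  | headed h => cases h <;> cases ha
  | _ => cases ha

/-- The two statements need each other: goodness at an arrow type is tested on a computable
argument, which the second statement provides. The second, at an arrow type, uses goodness of the
argument to induct on its reductions. -/
theorem comp_good_and_of_steps (hβ : IsBetaIDTS R ap) (hA : Assumptions R C stat)
    (hI : IsInterp R ap C I) (t : Ty A.B) :
    (∀ {Γ : List (Ty A.B)} {w : World A Γ} {a : PureTm A Γ t}, Comp ap I t w a → Good R ap w a) ∧
    ∀ {Γ : List (Ty A.B)} {w : World A Γ} {a : PureTm A Γ t}, ¬ Active ap C a →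
      LocalGood ap w a → (∀ b, Step R a b → Comp ap I t w b) → Comp ap I t w a := by
  induction t with
  | base b =>
    refine ⟨fun h => ((hI.iff ..).1 h).1, fun {Γ w a} ha hl hs => ?_⟩
    rw [Comp, hI.iff]
    refine ⟨good_of_steps hl fun d hd => ((hI.iff ..).1 (hs d hd)).1, fun ss c hc us hus => ?_⟩
    rcases Relation.ReflTransGen.cases_head hus with rfl | ⟨d, hd, hdc⟩
    · exact (ha (.ctor hc us)).elim
    · exact ((hI.iff ..).1 (hs d hd)).2 ss c hc us hdc
  | arr s t ihs iht =>
    constructor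
    · intro Γ w a h
      -- Named variables carry no label and are computable in every world; the function is then a
      -- subterm of a good application.
      have hx : Comp ap I s w (.fvar (Classical.choice (A.infinite_X s).nonempty)) :=
        ihs.2 not_active_fvar localGood_fvar fun b hb => (not_step_fvar hb).elim
      have h := iht.1 (h Γ w _ (Emb.refl w) _ hx)
      rw [Tm.rename_id] at h
      exact h.funSubterm (.arg _ _ .zero .self)
    · intro Γ w a ha hl hs Γ' w' r hr c hc
      have hsn := (ihs.1 hc).1
      induction hsn with
      | intro c _ ih =>
        refine iht.2 (fun h => ha (active_app hβ hA h).rename_reflect) ?_ ?_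
        · refine localGood_app ((localGood_rename hr).2 hl) ((ihs.1 hc).2 c .refl) ?_
          intro s' x hx
          exact (ha (Active.rename_reflect (.headed hx))).elim
        · intro v hv
          rcases hβ.step_app hv with ⟨a', ha', rfl⟩ | ⟨c', hc', rfl⟩ | ⟨q, hq, rfl⟩
          · obtain ⟨d, hd, rfl⟩ := Step.rename_reflect hr.inj ha'
            exact hs d hd Γ' w' r hr c hc
          · exact ih c' hc' (comp_step hI hc hc')
          · exact (ha (Active.rename_reflect (r := r) (hq ▸ .abs q))).elim

theorem Comp.good (hβ : IsBetaIDTS R ap) (hA : Assumptions R C stat) (hI : IsInterp R ap C I)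
    {w : World A Γ} {a : PureTm A Γ t} (h : Comp ap I t w a) : Good R ap w a :=
  (comp_good_and_of_steps hβ hA hI t).1 h

theorem comp_of_steps (hβ : IsBetaIDTS R ap) (hA : Assumptions R C stat) (hI : IsInterp R ap C I)
    {w : World A Γ} {a : PureTm A Γ t} (ha : ¬ Active ap C a) (hl : LocalGood ap w a)
    (hs : ∀ b, Step R a b → Comp ap I t w b) : Comp ap I t w a :=
  (comp_good_and_of_steps hβ hA hI t).2 ha hl hs

theorem comp_fvar (hβ : IsBetaIDTS R ap) (hA : Assumptions R C stat) (hI : IsInterp R ap C I)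
    {w : World A Γ} (x : A.X t) : Comp ap I t w (.fvar x) :=
  comp_of_steps hβ hA hI not_active_fvar localGood_fvar fun _ h => (not_step_fvar h).elim

theorem Comp.rename (hI : IsInterp R ap C I) {w : World A Γ} {w' : World A Γ'} {r : Ren Γ Γ'}
    (h : Emb w w' r) {a : PureTm A Γ t} : Comp ap I t w' (a.rename r) ↔ Comp ap I t w a :=
  stable_comp hI.stable t h a

/-- Induction on the reductions of the body and then of the argument. The body is strongly
normalizing because its instance by a named variable is. -/
theorem comp_abs (hβ : IsBetaIDTS R ap) (hA : Assumptions R C stat) (hI : IsInterp R ap C I)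
    {w : World A Γ} {q : PureTm A (s :: Γ) t}
    (h : ∀ (Γ' : List (Ty A.B)) (w' : World A Γ') (r : Ren Γ Γ'), Emb w w' r →
      ∀ c : PureTm A Γ' s, Comp ap I s w' c → Comp ap I t w' ((q.rename r.lift).instZero c)) :
    Comp ap I (.arr s t) w (.abs q) := by
  intro Γ' w' r hr c hc
  rw [Tm.rename_abs]
  have hq : ∀ c : PureTm A Γ' s, Comp ap I s w' c →
      Comp ap I t w' ((q.rename r.lift).instZero c) := h Γ' w' r hr
  generalize q.rename r.lift = q' at hq
  have hsn : SN R q' :=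
    SN.of_subst ((hq _ (comp_fvar hβ hA hI (Classical.choice (A.infinite_X s).nonempty))).good
      hβ hA hI).1
  induction hsn generalizing c with
  | intro q' _ ihq =>
    have hcn := (hc.good hβ hA hI).1
    induction hcn with
    | intro c _ ihc =>
      refine comp_of_steps hβ hA hI (fun h => ?_) ?_ ?_
      · rcases active_fn h with ⟨d, c, hc, e⟩ | ⟨r, x, hx⟩
        · exact ap_not_ctor hβ hA hc e
        · exact (headedBy_app hx).not_abs
      · refine localGood_app ?_ ((hc.good hβ hA hI).2 c .refl) fun x hx => hx.not_abs.elim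
        -- Local goodness does not look below abstractions, and an abstraction is not itself an
        -- application.
        intro s x s' t' b c hb hbc
        obtain ⟨e, h⟩ := Sigma.mk.inj (funSubterm_abs hbc)
        subst e
        cases eq_of_heq h
      · intro v hv
        rcases hβ.step_app hv with ⟨a', ha', rfl⟩ | ⟨c', hc', rfl⟩ | ⟨p, hp, rfl⟩
        · obtain ⟨p, hp, rfl⟩ := step_abs_iff.1 ha'
          exact ihq p hp c hc fun d hd => comp_step hI (hq d hd) (hp.subst _)
        · exact ihc c' hc' (comp_step hI hc hc')
        · cases hp
          exact hq c hc

/-- At base type the term keeps its index head under reduction and never reaches a constructor. At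
arrow type, applying it to a computable argument keeps it good, since the label of `x` accepts every
computable term, in all extensions. -/
theorem comp_headed (hβ : IsBetaIDTS R ap) (hA : Assumptions R C stat) (hI : IsInterp R ap C I)
    {w : World A Γ} {x : Var Γ s} {a : PureTm A Γ t} (h : HeadedBy ap x a)
    (hw : ∀ (Γ' : List (Ty A.B)) (w' : World A Γ') (r : Ren Γ Γ'), Emb w w' r →
      ∀ (t : Ty A.B) (c : PureTm A Γ' t), Comp ap I t w' c →
        (w' s (r s x)).holds Γ' (fun _ x => x) t c)
    (ha : Good R ap w a) : Comp ap I t w a := by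
  induction t generalizing Γ with
  | base b =>
    rw [Comp, hI.iff]
    refine ⟨ha, fun ss c hc us hus => ?_⟩
    have : ∀ d, Steps R a d → HeadedBy ap x d := by
      intro d hd
      induction hd with
      | refl => exact h
      | tail _ h' ih => exact ih.step hβ h'
    have := this _ hus
    generalize hd : Tm.fn c us = d at this
    cases this with
    | bvar => cases hd
    | app h e =>
      simp only [Tm.app, Tm.fn.injEq] at hd
      obtain ⟨rfl, h1, -⟩ := hd
      exact (ap_not_ctor hβ hA hc (by rw [eq_of_heq h1])).elim
  | arr s' t ihs iht =>
    intro Γ' w' r hr c hc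
    have hw' : ∀ (Γ'' : List (Ty A.B)) (w'' : World A Γ'') (q : Ren Γ' Γ''), Emb w' w'' q →
        ∀ (t : Ty A.B) (c : PureTm A Γ'' t), Comp ap I t w'' c →
          (w'' s (q s (r s x))).holds Γ'' (fun _ x => x) t c :=
      fun Γ'' w'' q hq => hw Γ'' w'' _ (hr.trans hq)
    have hcg := hc.good hβ hA hI
    have hag := (good_rename hr).2 ha
    have hah := h.rename r
    refine iht (x := r s x) (.app hah c) hw' ?_
    generalize a.rename r = a' at hag hah
    obtain ⟨hsn, hl⟩ := hag
    induction hsn generalizing c with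
    | intro a' _ iha =>
      have hcn := hcg.1
      induction hcn with
      | intro c _ ihc =>
        refine good_of_steps (localGood_app (hl a' .refl) (hcg.2 c .refl) ?_) ?_
        · intro s' y hy
          have key : ∀ {t : Ty A.B} {d : PureTm A Γ' t}, HeadedBy ap (r s x) d →
              ∀ {s'} {y : Var Γ' s'}, HeadedBy ap y d →
                (⟨s', y⟩ : Σ t, Var Γ' t) = ⟨s, r s x⟩ := by
            intro t d hd
            induction hd with
            | bvar =>
              intro s' y hy
              generalize hb : Tm.bvar (r s x) = d at hy
              cases hy with
              | bvar => cases hb; rfl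
              | app => cases hb
            | app h b ih => intro s' y hy; exact ih (headedBy_app hy)
          obtain ⟨rfl, hy⟩ := Sigma.mk.inj (key hah hy)
          cases eq_of_heq hy
          exact hw Γ' w' r hr _ c hc
        · intro v hv
          rcases hβ.step_app hv with ⟨b, hb, rfl⟩ | ⟨d, hd, rfl⟩ | ⟨p, rfl, rfl⟩
          · exact iha b hb c hc hcg (hah.step hβ hb) fun e he => hl e (.head hb he)
          · exact ihc d hd (comp_step hI hc hd) (hcg.step hd)
          · exact hah.not_abs.elim

end Computability

/-! ### Computability of accessible subterms -/

section Accessibility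

variable {A : Alphabet.{u, v, w, z}} {R : Set (Rule A)} {ap : AppSyms A} {C : Constructors A}
  {stat : Sym A → Status} {I : Interp A} {Γ Γ' Δ Θ : List (Ty A.B)} {s t : Ty A.B}

theorem BasicType.of_ble {b d : A.B} (hb : BasicType C b) (h : BLe C d b) : BasicType C d :=
  fun c hc => hb c (Relation.ReflTransGen.trans h hc)

/-- For basic types goodness alone suffices. A constructor reached by reduction has only arguments
of basic base types, which are good and smaller for the transitive closure of `Descends`; it is
transitive because several steps may precede the constructor. -/
theorem comp_of_basicType (hI : IsInterp R ap C I) {b : A.B} (hb : BasicType C b) {w : World A Γ}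
    {a : PureTm A Γ (.base b)} (ha : Good R ap w a) : Comp ap I (.base b) w a := by
  have key : ∀ p : Σ t, PureTm A Γ t, Acc (Relation.TransGen (Descends R)) p →
      ∀ {b : A.B} {a : PureTm A Γ (.base b)}, BasicType C b → Good R ap w a → p = ⟨_, a⟩ →
        Comp ap I (.base b) w a := by
    intro p hp
    induction hp with
    | intro p _ ih =>
      rintro b a hb ha rfl
      rw [Comp, hI.iff]
      refine ⟨ha, fun ss c hc us hus r i => ?_⟩
      obtain ⟨d, rfl⟩ := (hb b .refl ss c hc).2 r i.mem
      have hsub : FunSubterm (us (.base d) i) (Tm.fn c us) := .arg c us i .self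
      have hg : Good R ap w (Tm.fn c us) := ha.steps hus
      refine ih ⟨_, us _ i⟩ ?_ (hb.of_ble (.single ⟨ss, c, hc, _, i.mem, true, rfl, rfl⟩))
        (hg.funSubterm hsub) rfl
      have h1 : Descends R ⟨_, us (.base d) i⟩ ⟨_, Tm.fn c us⟩ := .covered (.fn c us i .self)
      have h2 : ∀ d : PureTm A Γ (.base b), Steps R a d →
          Relation.ReflTransGen (Descends R) ⟨_, d⟩ ⟨_, a⟩ := by
        intro d hd
        induction hd with
        | refl => exact .refl
        | tail _ h ih => exact .head (.step h) ih
      exact .head' h1 (h2 _ hus)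
  exact key _ ha.1.acc_descends.transGen hb ha rfl

theorem exists_update (e : Env A (fun _ _ => Empty) Δ Γ) (x : Var Δ s) (p : PureTm A Γ s) :
    ∃ e' : Env A (fun _ _ => Empty) Δ Γ, e' s x = p ∧
      ∀ t y, (⟨t, y⟩ : Σ t, Var Δ t) ≠ ⟨s, x⟩ → e' t y = e t y := by
  classical
  refine ⟨fun t y => Function.update (β := fun q : Σ t, Var Δ t => PureTm A Γ q.1)
    (fun q => e q.1 q.2) ⟨s, x⟩ p ⟨t, y⟩, ?_, fun t y h => ?_⟩
  · exact Function.update_self ..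
  · exact Function.update_of_ne h ..

theorem Tm.inst_abs_instZero (σ : Valuation A Γ) (b : MetaTm A (s :: Δ) t)
    (e : Env A (fun _ _ => Empty) Δ Θ) (d : Env A (fun _ _ => Empty) Γ Θ) (p : PureTm A Θ s) :
    (b.inst σ e.lift (fun t x => (d t x).rename (fun _ y => .succ y))).instZero p =
      b.inst σ (consFam (P := PureTm A Θ) p e) d := by
  rw [Tm.instZero, Tm.inst_subst]
  congr 1
  · funext t x
    cases x with
    | zero => rfl
    | succ x =>
      simp only [consFam_succ, Tm.rename_subst]
      exact Tm.subst_id _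
  · funext t x
    simp only [Tm.rename_subst]
    exact Tm.subst_id _

theorem Tm.inst_apps (σ : Valuation A Γ) (e : Env A (fun _ _ => Empty) Δ Θ)
    (d : Env A (fun _ _ => Empty) Γ Θ) {ss : List (Ty A.B)} (a : MetaTm A Δ (Ty.arrows ss t))
    (us : Env A A.Z ss Δ) : (Tm.apps ap a us).inst σ e d =
      Tm.apps ap (a.inst σ e d) (fun t i => (us t i).inst σ e d) := by
  induction ss with
  | nil => rfl
  | cons s ss ih =>
    simp only [Tm.apps]
    exact (ih (Tm.app ap a (us s .zero)) _).trans
      (congrArg (fun b => Tm.apps ap b fun t i => (us t (.succ i)).inst σ e d)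
        (Tm.inst_app ap σ a (us s .zero) e d))

theorem funSubterm_apps {ss : List (Ty A.B)} (a : PureTm A Γ (Ty.arrows ss t))
    (us : Env A (fun _ _ => Empty) ss Γ) : FunSubterm a (Tm.apps ap a us) := by
  induction ss with
  | nil => exact .self
  | cons s ss ih =>
    exact FunSubterm.trans (.arg _ _ .zero .self)
      (ih (Tm.app ap a (us s .zero)) (fun r i => us r (.succ i)))

theorem LocalGood.apps {w : World A Γ} {x : Var Γ s} {ss : List (Ty A.B)}
    {a : PureTm A Γ (Ty.arrows ss t)} {us : Env A (fun _ _ => Empty) ss Γ}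
    (h : LocalGood ap w (Tm.apps ap a us)) (hx : HeadedBy ap x a) (r : Ty A.B) (i : Var ss r) :
    (w s x).holds Γ (fun _ x => x) r (us r i) := by
  induction i with
  | @zero ss s' =>
    exact h x a (us s' .zero) hx
      (funSubterm_apps (Tm.app ap a (us s' .zero)) (fun r i => us r (.succ i)))
  | @succ ss s' r i ih =>
    exact ih (a := Tm.app ap a (us s' .zero)) (us := fun r i => us r (.succ i)) h (hx.app _)

/-- The condition that a term is computable in some extension of the world `w`. -/
def compLabel (hI : IsInterp R ap C I) (w : World A Γ) : Label A Γ where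
  holds Γ₁ k t a := ∃ (Γ₂ : List (Ty A.B)) (w₂ : World A Γ₂) (q : Ren Γ₁ Γ₂), q.Inj ∧
    Emb w w₂ (fun s x => q s (k s x)) ∧ Comp ap I t w₂ (a.rename q)
  inv {Γ₁ Γ₃} k j hj t a := by
    constructor
    · rintro ⟨Γ₂, w₂, q, hq, hw, ha⟩
      rw [Tm.rename_rename] at ha
      exact ⟨Γ₂, w₂, _, fun t x y h => hj t (hq t h), hw, ha⟩
    · rintro ⟨Γ₂, w₂, q, hq, hw, ha⟩
      obtain ⟨Γ₄, i, i', hi, hi', e, -⟩ := exists_amalgam hj hq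
      obtain ⟨w₄, hw₄⟩ := exists_push w₂ hi'
      refine ⟨Γ₄, w₄, i, hi, ?_, ?_⟩
      · simp only [e]
        exact hw.trans hw₄
      · rw [Tm.rename_rename]
        simp only [e]
        rw [← Tm.rename_rename]
        exact (Comp.rename hI hw₄).2 ha

/-- The new index is labelled by `compLabel`. Computable arguments satisfy this label by taking the
trivial further extension, so the index is computable. Conversely an argument satisfying it is
computable in some extension of `w`, hence in `w` because embeddings reflect computability. -/
theorem exists_fresh (hβ : IsBetaIDTS R ap) (hA : Assumptions R C stat) (hI : IsInterp R ap C I)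
    (w : World A Γ) (s : Ty A.B) : ∃ w' : World A (s :: Γ), Emb w w' (fun _ x => .succ x) ∧
      Comp ap I s w' (.bvar .zero) ∧ ∀ (t : Ty A.B) (a : PureTm A Γ t),
        (w' s .zero).holds (s :: Γ) (fun _ x => x) t (a.rename (fun _ x => .succ x)) →
          Comp ap I t w a := by
  let w' : World A (s :: Γ) := consFam (P := fun _ => Label A (s :: Γ))
    ((compLabel hI w).tr (fun _ x => .succ x)) (fun t x => (w t x).tr (fun _ x => .succ x))
  have hw : Emb w w' (fun _ x => .succ x) := ⟨Var.succ_inj_ren, fun _ _ => rfl⟩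
  refine ⟨w', hw, ?_, fun t a h => ?_⟩
  · refine comp_headed hβ hA hI .bvar ?_ ?_
    · intro Γ₁ w₁ k hk t c hc
      rw [hk.compat]
      refine ⟨Γ₁, w₁, fun _ x => x, fun _ _ _ h => h, hw.trans hk, ?_⟩
      rwa [Tm.rename_id]
    · refine good_of_steps ?_ fun b hb => (not_step_bvar hb).elim
      intro s' x s'' t' b c hb hbc
      obtain ⟨rfl, h⟩ := Sigma.mk.inj (funSubterm_bvar hbc)
      cases eq_of_heq h
  · have h' := ((compLabel hI w).inv (fun _ x => x) (fun _ x => Var.succ x)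
      Var.succ_inj_ren a).1 h
    obtain ⟨Γ₂, w₂, q, -, hq, hc⟩ := h'
    exact (Comp.rename hI hq).1 hc

/-- Quantifying over all computable environments for the indices of `a`, in all extensions of `w`,
is what allows an index to be reassigned in the two clauses concerning `@` and variables. -/
theorem comp_of_accessible (hβ : IsBetaIDTS R ap) (hA : Assumptions R C stat)
    (hI : IsInterp R ap C I) {r : Ty A.B} {v : MetaTm A [] r} {σ : Valuation A Γ} {w : World A Γ}
    (hv : Comp ap I r w (v.val σ)) {a : MetaTm A Δ t} (h : Accessible C ap v a) :
    ∀ {Γ' : List (Ty A.B)} {w' : World A Γ'} {ρ : Ren Γ Γ'}, Emb w w' ρ →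
      ∀ e : Env A (fun _ _ => Empty) Δ Γ', (∀ s x, Comp ap I s w' (e s x)) →
        Comp ap I t w' (a.inst σ e ρ.env) := by
  induction h with
  | self =>
    intro Γ' w' ρ hρ e he
    have : v.inst σ e ρ.env = (v.val σ).rename ρ := (Tm.rename_eq_subst _ _).symm
    rw [this]
    exact (Comp.rename hI hρ).2 hv
  | @abs Δ s t a h ih =>
    intro Γ' w' ρ hρ e he
    have h1 := ih hρ (fun t x => e t (.succ x)) (fun s x => he s _) Γ' w' _ (Emb.refl w')
      (e s .zero) (he s .zero)
    rw [Tm.rename_id, Tm.inst_abs] at h1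
    have h2 := comp_step hI h1 (hβ.step_beta _ _)
    -- Applying the abstraction to the value of its index and contracting the β-redex yields exactly
    -- the instance of the body.
    rw [Tm.inst_abs_instZero, consFam_eta (P := PureTm A Γ') e] at h2
    exact h2
  | ctor hc h t i ih =>
    intro Γ' w' ρ hρ e he
    have h1 := ih hρ e he
    rw [Comp, hI.iff] at h1
    exact h1.2 _ _ hc _ .refl t i
  | basic h hb i ih =>
    intro Γ' w' ρ hρ e he
    exact comp_of_basicType hI hb (((ih hρ e he).good hβ hA hI).funSubterm (.arg _ _ i .self))
  | @appVar Δ s t a x h hx ih =>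
    intro Γ' w' ρ hρ e he Γ₂ w₂ q hq c hc
    -- As `x` is not free in `a`, it may be given the arbitrary argument `c` without affecting the
    -- instance of `a`.
    obtain ⟨e', h1, h2⟩ := exists_update (fun t y => (e t y).rename q) x c
    have h3 := ih (hρ.trans hq) e' (fun s' y => by
      by_cases hy : (⟨s', y⟩ : Σ t, Var Δ t) = ⟨s, x⟩
      · cases hy
        exact h1 ▸ hc
      · rw [h2 s' y hy]
        exact (Comp.rename hI hq).2 (he s' y))
    rw [Tm.inst_app, Tm.inst_bvar, h1] at h3
    rw [Tm.inst_rename, Tm.inst_congr σ _ _ a e']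
    · exact h3
    · intro s' y hy
      refine (h2 s' y ?_).symm
      intro hyx
      exact hx (hyx ▸ hy)
  | @varApps Δ ss s x us h hx t i ih =>
    intro Γ' w' ρ hρ e he
    -- Here `x` is given the fresh index whose label demands computable arguments; goodness of the
    -- instance of `@(x, us)` then yields the label for each argument.
    obtain ⟨w₂, hw₂, hz, hl⟩ := exists_fresh hβ hA hI w' (Ty.arrows ss s)
    obtain ⟨e', h1, h2⟩ := exists_update
      (fun t y => (e t y).rename (fun _ y => Var.succ (s := Ty.arrows ss s) y)) x (.bvar .zero)
    have h3 := ih (hρ.trans hw₂) e' (fun s' y => by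
      by_cases hy : (⟨s', y⟩ : Σ t, Var Δ t) = ⟨_, x⟩
      · cases hy
        exact h1 ▸ hz
      · rw [h2 s' y hy]
        exact (Comp.rename hI hw₂).2 (he s' y))
    rw [Tm.inst_apps, Tm.inst_bvar, h1] at h3
    have h4 := ((h3.good hβ hA hI).2 _ .refl).apps .bvar t i
    refine hl t _ ?_
    rw [Tm.inst_rename, Tm.inst_congr σ _ _ _ e']
    · exact h4
    · intro s' y hy
      refine (h2 s' y ?_).symm
      intro hyx
      exact hx t i (hyx ▸ hy)

end Accessibility

/-! ### Computability of function symbols and adequacy -/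

section Symbols

variable {A : Alphabet.{u, v, w, z}} {R : Set (Rule A)} {ap : AppSyms A} {C : Constructors A}
  {stat : Sym A → Status} {I : Interp A} {Γ Γ' Δ Θ : List (Ty A.B)} {s t : Ty A.B}

/-- The ranks of the arguments of a symbol. -/
noncomputable def argRanks (R : Set (Rule A)) {ss : List (Ty A.B)}
    (us : Env A (fun _ _ => Empty) ss Γ) : List Ordinal.{max u v w} :=
  (argList us).map (descentRank R)

theorem statLt_argRanks {ss : List (Ty A.B)} {us vs : Env A (fun _ _ => Empty) ss Γ}
    (hus : ∀ r i, SN R (us r i)) {r : Ty A.B} (i : Var ss r) (h : Step R (us r i) (vs r i))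
    (he : ∀ t₁ (j : Var ss t₁), (⟨t₁, j⟩ : Σ t, Var ss t) ≠ ⟨r, i⟩ → us t₁ j = vs t₁ j)
    (st : Status) :
    StatLt (fun a b => a < b) (st ++ [Set.univ]) (argRanks R vs) (argRanks R us) := by
  obtain ⟨p, q, h1, h2⟩ := argList_split i he
  simp only [argRanks, h1, h2, List.map_append, List.map_cons]
  exact statLt_of_lt st _ _ (descentRank_lt (.step h) (hus r i).acc_descends)

theorem comp_of_step_arg {ss : List (Ty A.B)} {us vs : Env A (fun _ _ => Empty) ss Γ}
    (hI : IsInterp R ap C I) {w : World A Γ} (hus : ∀ r i, Comp ap I r w (us r i)) {r : Ty A.B}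
    (i : Var ss r) (h : Step R (us r i) (vs r i))
    (he : ∀ t₁ (j : Var ss t₁), (⟨t₁, j⟩ : Σ t, Var ss t) ≠ ⟨r, i⟩ → us t₁ j = vs t₁ j)
    (r' : Ty A.B) (j : Var ss r') : Comp ap I r' w (vs r' j) := by
  by_cases hj : (⟨r', j⟩ : Σ t, Var ss t) = ⟨r, i⟩
  · cases hj
    exact comp_step hI (hus r i) h
  · rw [← he r' j hj]
    exact hus r' j

/-- No rule applies at the root, so every step decreases the rank of an argument and preserves
computability of the arguments. -/
theorem comp_ctor (hβ : IsBetaIDTS R ap) (hA : Assumptions R C stat) (hI : IsInterp R ap C I)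
    {b : A.B} {ss : List (Ty A.B)} {c : A.F ss (.base b)} (hc : c ∈ C b ss) {w : World A Γ}
    {us : Env A (fun _ _ => Empty) ss Γ} (hus : ∀ r i, Comp ap I r w (us r i)) :
    Comp ap I (.base b) w (.fn c us) := by
  generalize hm : argRanks R us = l
  induction l using (statLt_wf (α := Ordinal) ([] ++ [Set.univ])).induction generalizing us with
  | _ l ih =>
    subst hm
    have hstep : ∀ v, Step R (.fn c us) v → Comp ap I (.base b) w v := by
      intro v hv
      rcases step_fn hv with ⟨l, r, h1, h2, h3, h4, σ, hR, -, -⟩ | ⟨r, i, vs, hi, he, rfl⟩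
      · exact (hA.head_not_ctor _ hR b ss c hc rfl).elim
      · exact ih _ (statLt_argRanks (fun r i => ((hus r i).good hβ hA hI).1) i hi he [])
          (comp_of_step_arg hI hus i hi he) rfl
    rw [Comp, hI.iff]
    constructor
    · refine good_of_steps (localGood_fn (fun r i => ((hus r i).good hβ hA hI).2 _ .refl) ?_)
        fun v hv => (hstep v hv).good hβ hA hI
      intro s' d e h
      simp only [Tm.app, Tm.fn.injEq] at h
      obtain ⟨rfl, h, -⟩ := h
      exact (ap_not_ctor hβ hA hc (by rw [eq_of_heq h])).elim
    · intro ss' c' hc' vs hvs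
      rcases Relation.ReflTransGen.cases_head hvs with h | ⟨d, hd, hdv⟩
      · cases h
        exact hus
      · exact ((hI.iff ..).1 (hstep d hd)).2 ss' c' hc' vs hdv

/-- Induction on the computable closure. The hypotheses `hlt` and `heq` are the induction hypotheses
of `comp_fn`, for smaller symbols and for equivalent symbols with smaller arguments. -/
theorem comp_of_cc (hβ : IsBetaIDTS R ap) (hA : Assumptions R C stat) (hI : IsInterp R ap C I)
    {ls : List (Ty A.B)} {lt : Ty A.B} {f : A.F ls lt} {l : Env A A.Z ls []} {σ : Valuation A Γ}
    {w : World A Γ} (hl : ∀ r i, Comp ap I r w ((l r i).val σ))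
    (hlt : ∀ {ss : List (Ty A.B)} {s : Ty A.B} (h : A.F ss s), FLt R ⟨_, _, h⟩ ⟨_, _, f⟩ →
      ∀ {Γ' : List (Ty A.B)} {w' : World A Γ'} {us : Env A (fun _ _ => Empty) ss Γ'},
        (∀ r i, Comp ap I r w' (us r i)) → Comp ap I s w' (.fn h us))
    (heq : ∀ {ss : List (Ty A.B)} {s : Ty A.B} (g : A.F ss s), FEq R ⟨_, _, g⟩ ⟨_, _, f⟩ →
      ∀ {Γ' : List (Ty A.B)} {w' : World A Γ'} {us : Env A (fun _ _ => Empty) ss Γ'},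
        (∀ r i, Comp ap I r w' (us r i)) →
        StatLt (fun a b => a < b) (stat ⟨_, _, f⟩) (argRanks R us)
          (argRanks R fun t i => (l t i).val σ) → Comp ap I s w' (.fn g us))
    {a : MetaTm A Δ t} (h : CC R ap C stat f l a) :
    ∀ {Γ' : List (Ty A.B)} {w' : World A Γ'} {ρ : Ren Γ Γ'}, Emb w w' ρ →
      ∀ e : Env A (fun _ _ => Empty) Δ Γ', (∀ s x, Comp ap I s w' (e s x)) →
        Comp ap I t w' (a.inst σ e ρ.env) := by
  induction h with
  | @mv Δ ss s Y hY us hu ih =>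
    intro Γ' w' ρ hρ e he
    obtain ⟨r, i, Δ', y, hy, hacc⟩ := hY
    classical
    -- The accessible occurrence is `Y(y)` with the `y` distinct, so sending `y t j` to the instance
    -- of the argument `us t j` is well defined and turns the instance of `Y(y)` into that of
    -- `Y(us)`. Other indices get a computable named variable.
    let e' : Env A (fun _ _ => Empty) Δ' Γ' := fun t x =>
      if h : ∃ j, y t j = x then (us t h.choose).inst σ e ρ.env
      else .fvar (Classical.choice (A.infinite_X t).nonempty)
    have h1 : ∀ t j, e' t (y t j) = (us t j).inst σ e ρ.env := by
      intro t j
      have hj : ∃ j', y t j' = y t j := ⟨j, rfl⟩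
      simp only [e', dif_pos hj]
      rw [hy t hj.choose_spec]
    have h2 := comp_of_accessible hβ hA hI (hl r i) hacc hρ e' (fun t x => by
      by_cases hx : ∃ j, y t j = x
      · obtain ⟨j, rfl⟩ := hx
        rw [h1]
        exact ih t j hρ e he
      · simp only [e', dif_neg hx]
        exact comp_fvar hβ hA hI _)
    rw [Tm.inst_mv] at h2 ⊢
    simp only [Tm.inst_bvar, h1] at h2
    exact h2
  | bvar x => intro Γ' w' ρ hρ e he; rw [Tm.inst_bvar]; exact he _ x
  | fvar x => intro Γ' w' ρ hρ e he; exact comp_fvar hβ hA hI x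
  | ctor c hc us hu ih =>
    intro Γ' w' ρ hρ e he
    exact comp_ctor hβ hA hI hc fun r i => ih r i hρ e he
  | app ha hb iha ihb =>
    intro Γ' w' ρ hρ e he
    have := iha hρ e he Γ' w' _ (Emb.refl w') _ (ihb hρ e he)
    rwa [Tm.rename_id, ← Tm.inst_app] at this
  | abs ha ih =>
    intro Γ' w' ρ hρ e he
    rw [Tm.inst_abs]
    refine comp_abs hβ hA hI fun Γ₂ w₂ q hq c hc => ?_
    have h1 := ih (hρ.trans hq) (consFam (P := PureTm A Γ₂) c fun t x => (e t x).rename q)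
      (fun s x => by
        cases x with
        | zero => exact hc
        | succ x => exact (Comp.rename hI hq).2 (he _ x))
    rw [← Tm.inst_abs_instZero] at h1
    convert h1 using 2
    rw [Tm.inst_rename]
    congr 1
    funext t x
    cases x with
    | zero => rfl
    | succ x => simp only [consFam_succ, Tm.rename_rename]
  | lower h hh us hu ih =>
    intro Γ' w' ρ hρ e he
    exact hlt h hh fun r i => ih r i hρ e he
  | @equiv Δ ss s g hg hss us hu hst ih =>
    intro Γ' w' ρ hρ e he
    refine heq g hg (fun r i => ih r i hρ e he) ?_
    have hsn : ∀ r i, Acc (Descends R) ⟨r, (l r i).val σ⟩ := fun r i =>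
      ((hl r i).good hβ hA hI).1.acc_descends
    -- The recursive call may stand below abstractions, in a larger scope than the redex. There the
    -- left-hand side arguments appear renamed, with the same ranks.
    have hrank : ∀ r i, descentRank R ⟨r, ((l r i).weaken Δ).inst σ e ρ.env⟩ =
        descentRank R ⟨r, (l r i).val σ⟩ := by
      intro r i
      rw [Tm.inst_weaken, ← Tm.rename_eq_subst]
      exact descentRank_rename hρ.inj (hsn r i)
    have h1 := hst.map (q := fun a b => a < b)
      (f := fun a => descentRank R ⟨a.1, a.2.inst σ e ρ.env⟩) (fun a b hb hab => by
        obtain ⟨r, i, rfl⟩ := mem_argList hb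
        rcases covered_inst hab.1 σ e ρ.env with h | h
        · exact (hab.2 h).elim
        · refine descentRank_lt (.covered h) ?_
          rw [Tm.inst_weaken, ← Tm.rename_eq_subst]
          exact ((SN.rename hρ.inj).2 ((hl r i).good hβ hA hI).1).acc_descends)
    convert h1 using 1
    · exact (congrArg _ (argList_map (M := A.Z) (M' := fun _ _ => Empty) (us := us)
        fun t a => a.inst σ e ρ.env)).trans List.map_map
    · refine (congrArg _ (argList_map (M := A.Z) (M' := fun _ _ => Empty) (Δ := Γ) (us := l)
        fun t a => Tm.val (Δ := []) σ a)).trans ?_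
      rw [argList_map (us := l) (fun t a => a.weaken Δ), List.map_map, List.map_map]
      refine List.map_congr_left fun a ha => ?_
      obtain ⟨r, i, rfl⟩ := mem_argList ha
      exact (hrank r i).symm

/-- The inner induction treats all symbols equivalent to `f` together, on argument ranks under the
status of `f` extended by `Set.univ`. Recursive calls decrease the status part, and steps inside an
argument decrease the extended one. -/
theorem comp_fn (hβ : IsBetaIDTS R ap) (hA : Assumptions R C stat) (hI : IsInterp R ap C I)
    (hGS : ∀ ρ ∈ R, GeneralSchema R ap C stat ρ) (f : Sym A) {w : World A Γ}
    {us : Env A (fun _ _ => Empty) f.1 Γ} (hus : ∀ r i, Comp ap I r w (us r i)) :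
    Comp ap I f.2.1 w (.fn f.2.2 us) := by
  induction f using hA.wf_sym.induction generalizing Γ with
  | _ f ihf =>
    have key : ∀ (m : List Ordinal) {ss : List (Ty A.B)} {s : Ty A.B} (g : A.F ss s),
        FEq R ⟨ss, s, g⟩ f → ∀ {Γ : List (Ty A.B)} {w : World A Γ}
          {us : Env A (fun _ _ => Empty) ss Γ}, (∀ r i, Comp ap I r w (us r i)) →
          argRanks R us = m → Comp ap I s w (.fn g us) := by
      intro m
      induction m using (statLt_wf (α := Ordinal) (stat f ++ [Set.univ])).induction with
      | _ m ihm =>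
        rintro ss s g hg Γ w us hus rfl
        by_cases hc : ∃ b, ∃ c : A.F ss (.base b), c ∈ C b ss ∧
            (⟨ss, s, g⟩ : Sym A) = ⟨ss, .base b, c⟩
        · obtain ⟨b, c, hc, e⟩ := hc
          cases e
          exact comp_ctor hβ hA hI hc hus
        -- Application symbols need no induction: the claim is the definition of computability at an
        -- arrow type.
        by_cases ha : ∃ s' t', (⟨ss, s, g⟩ : Sym A) = ⟨_, _, ap s' t'⟩
        · obtain ⟨s', t', e⟩ := ha
          cases e
          have := hus _ .zero Γ w _ (Emb.refl w) _ (hus _ (.succ .zero))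
          rwa [Tm.rename_id, ← fn_ap_eq_app] at this
        have happ : ∀ {s' : Ty A.B} {b : PureTm A Γ (.arr s' s)} {c : PureTm A Γ s'},
            Tm.fn g us ≠ Tm.app ap b c := by
          intro s' b c h
          simp only [Tm.app, Tm.fn.injEq] at h
          obtain ⟨rfl, h, -⟩ := h
          exact ha ⟨_, _, by rw [eq_of_heq h]⟩
        refine comp_of_steps hβ hA hI (fun h => ?_)
          (localGood_fn (fun r i => ((hus r i).good hβ hA hI).2 _ .refl)
            fun h => (happ h).elim) fun v hv => ?_
        · rcases active_fn h with h | ⟨r, x, h⟩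
          · exact hc h
          · generalize he : Tm.fn g us = a at h
            cases h with
            | bvar => cases he
            | app h b => exact happ he
        · rcases step_fn hv with ⟨l, r, h1, h2, h3, h4, σ, hR, rfl, rfl⟩ | ⟨r, i, vs, hi, he, rfl⟩
          · have hcc := hGS _ hR
            have := comp_of_cc hβ hA hI hus (fun h hh Γ' w' us' hus' => ?_)
              (fun g' hg' Γ' w' us' hus' hlt => ?_) hcc (Emb.refl w) nilFam
              (fun _ x => nomatch x)
            · rw [Tm.val_eq_inst]
              exact this
            · exact ihf ⟨_, _, h⟩ ⟨Relation.ReflTransGen.trans hg.1 hh.1, fun h' =>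
                hh.2 (Relation.ReflTransGen.trans h' hg.1)⟩ hus'
            -- The schema for the rule uses the status of `g`, the induction that of `f`; they agree
            -- on equivalent symbols.
            · rw [hA.stat_eq _ _ hg] at hlt
              exact ihm _ (hlt.append _) g' ⟨Relation.ReflTransGen.trans hg.1 hg'.1,
                Relation.ReflTransGen.trans hg'.2 hg.2⟩ hus' rfl
          · exact ihm _ (statLt_argRanks (fun r i => ((hus r i).good hβ hA hI).1) i hi he _) g hg
              (comp_of_step_arg hI hus i hi he) rfl
    exact key _ f.2.2 ⟨.refl, .refl⟩ hus rfl

/-- Adequacy, by structural induction. The substitution and the target world are general so that the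
abstraction case can instantiate the bound index by any computable term. -/
theorem comp_subst (hβ : IsBetaIDTS R ap) (hA : Assumptions R C stat) (hI : IsInterp R ap C I)
    (hGS : ∀ ρ ∈ R, GeneralSchema R ap C stat ρ) (a : PureTm A Δ t) {w : World A Γ}
    (e : Env A (fun _ _ => Empty) Δ Γ) (he : ∀ s x, Comp ap I s w (e s x)) :
    Comp ap I t w (a.subst e) := by
  induction a generalizing Γ with
  | bvar x => exact he _ x
  | fvar x => exact comp_fvar hβ hA hI x
  | abs b ih =>
    refine comp_abs hβ hA hI fun Γ' w' q hq c hc => ?_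
    have h1 := ih (w := w') (consFam (P := PureTm A Γ') c fun t x => (e t x).rename q)
      (fun s x => by
        cases x with
        | zero => exact hc
        | succ x => exact (Comp.rename hI hq).2 (he _ x))
    convert h1 using 1
    rw [Tm.subst_rename, Tm.instZero, Tm.subst_subst]
    congr 1
    funext t x
    cases x with
    | zero => rfl
    | succ x =>
      simp only [consFam_succ, Tm.rename_rename, Tm.rename_subst]
      exact (Tm.rename_eq_subst _ _).symm
  | fn f us ih => exact comp_fn hβ hA hI hGS ⟨_, _, f⟩ fun r i => ih r i e he
  | mv Y us ih => exact Y.elim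

end Symbols

end IDTS

theorem theorem1 (A : IDTS.Alphabet) (R : Set (IDTS.Rule A)) (ap : IDTS.AppSyms A)
    (hβ : IDTS.IsBetaIDTS R ap) (C : IDTS.Constructors A) (stat : IDTS.Sym A → IDTS.Status)
    (hA : IDTS.Assumptions R C stat)
    (hGS : ∀ ρ ∈ R, IDTS.GeneralSchema R ap C stat ρ) :
    IDTS.StronglyNormalizing R := by
  obtain ⟨I, hI⟩ := IDTS.exists_isInterp (ap := ap) hA
  refine fun t => ⟨fun a => ?_⟩
  -- A complete term has no indices, so the world and the substitution hypothesis are vacuous; free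
  -- variables are named and always computable.
  have h := IDTS.comp_subst hβ hA hI hGS a (Γ := []) (w := fun _ x => nomatch x)
    (fun _ x => .bvar x) (fun _ x => nomatch x)
  rw [IDTS.Tm.subst_id] at h
  exact (h.good hβ hA hI).1
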